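/- Let $\mathrm{Gr}(n,d)$ be the set of $d$-dimensional linear subspaces of $\mathbb{R}^n$; a uniformly random $d$-dimensional subspace is one distributed according to the unique probability measure on $\mathrm{Gr}(n,d)$ invariant under the orthogonal group. For a subspace $V$ let $\Pi_V$ be the $n\times n$ matrix of the orthogonal projection onto $V$. A degree-4 SoS SDP solution (for Boolean optimization in $n$ variables) is a real symmetric positive semidefinite matrix $\mathcal{M}$ with rows and columns indexed by the subsets of $[n]$ of size at most $2$, such that $\mathcal{M}[\emptyset,\emptyset]=1$ and $\mathcal{M}[S,T]=\mathcal{M}[S',T']$ whenever $S\Delta T=S'\Delta T'$. Its value for the problem $\frac1n\max_{x\in\{\pm1\}^n}x^{\top}\Pi_V x$ is $\frac1n\sum_{i,j=1}^n(\Pi_V)_{ij}\,\mathcal{M}[\{i\},\{j\}]$. Theorem. There are sequences $\varepsilon_n\to0$ and $\delta_n\to0$ such that for all $n$ and all integers $d$ with $n^{0.99}\le d\le n$, if $V$ is a uniformly random $d$-dimensional subspace of $\mathbb{R}^n$, then with probability at least $1-\delta_n$ there exists a degree-4 SoS SDP solution with value at least $1-\varepsilon_n$ for $\frac1n\max_{x\in\{\pm1\}^n}x^{\top}\Pi_V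 x$. -/

import Mathlib

/-- The Grassmannian `Gr(n, d)`: the `d`-dimensional linear subspaces of Euclidean space `ℝⁿ`. -/
def Gr (n d : ℕ) : Type :=
  {V : Submodule ℝ (EuclideanSpace ℝ (Fin n)) // Module.finrank ℝ V = d}

/-- The matrix, in the standard basis, of the orthogonal projection `Π_V` onto the subspace `V`. -/
noncomputable def projMatrix {n : ℕ} (V : Submodule ℝ (EuclideanSpace ℝ (Fin n))) :
    Matrix (Fin n) (Fin n) ℝ :=
  Matrix.of fun i j => V.starProjection (EuclideanSpace.single j 1) i

/-- The Borel σ-algebra of the Grassmannian, whose topology is the one induced by the embedding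
`V ↦ Π_V` into the space of real `n × n` matrices. -/
noncomputable instance Gr.instMeasurableSpace (n d : ℕ) : MeasurableSpace (Gr n d) :=
  MeasurableSpace.comap (fun (V : Gr n d) (i j : Fin n) => projMatrix V.1 i j) inferInstance

/-- The action of the orthogonal group on the Grassmannian: `V ↦ U V`. -/
noncomputable def Gr.rotate {n d : ℕ} (U : EuclideanSpace ℝ (Fin n) ≃ₗᵢ[ℝ] EuclideanSpace ℝ (Fin n))
    (V : Gr n d) : Gr n d :=
  ⟨V.1.map (U.toLinearEquiv : EuclideanSpace ℝ (Fin n) →ₗ[ℝ] EuclideanSpace ℝ (Fin n)),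
    (LinearEquiv.finrank_map_eq U.toLinearEquiv V.1).trans V.2⟩

/-- `μ` is the law of a uniformly random `d`-dimensional subspace of `ℝⁿ`: the (unique) probability
measure on the Grassmannian that is invariant under the orthogonal group. -/
structure IsUniformSubspaceLaw {n d : ℕ} (μ : MeasureTheory.Measure (Gr n d)) : Prop where
  isProbabilityMeasure : MeasureTheory.IsProbabilityMeasure μ
  invariant : ∀ U : EuclideanSpace ℝ (Fin n) ≃ₗᵢ[ℝ] EuclideanSpace ℝ (Fin n),
    MeasureTheory.MeasurePreserving (Gr.rotate U) μ μ

/-- The subsets of `[n]` of size at most `2`. -/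
abbrev SmallSet (n : ℕ) : Type := {S : Finset (Fin n) // S.card ≤ 2}

/-- The empty set as an index. -/
def SmallSet.empty (n : ℕ) : SmallSet n := ⟨∅, by simp⟩

/-- The singleton `{i}` as an index. -/
def SmallSet.single {n : ℕ} (i : Fin n) : SmallSet n := ⟨{i}, by simp⟩

/-- The feasible set of the degree-4 SoS SDP for Boolean optimization: pseudomoment matrices indexed
by the subsets of `[n]` of size at most `2`. -/
structure IsSoS4 {n : ℕ} (M : Matrix (SmallSet n) (SmallSet n) ℝ) : Prop where
  symm : ∀ S T S' T' : SmallSet n,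
    symmDiff S.1 T.1 = symmDiff S'.1 T'.1 → M S T = M S' T'
  normalized : M (SmallSet.empty n) (SmallSet.empty n) = 1
  posSemidef : M.PosSemidef

/-- The value `⟨A, M⟩ = ∑ A_{ij} M[{i},{j}]` of a pseudomoment matrix `M` for the problem of
maximizing the quadratic form `xᵀ A x` over `x ∈ {±1}ⁿ`. -/
noncomputable def sosValue {n : ℕ} (A : Matrix (Fin n) (Fin n) ℝ)
    (M : Matrix (SmallSet n) (SmallSet n) ℝ) : ℝ :=
  ∑ i, ∑ j, A i j * M (SmallSet.single i) (SmallSet.single j)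

/-! A uniformly random `d`-dimensional subspace can be taken to contain the columns of an `n × d`
Gaussian matrix. Let `x i` be its rows, `v i = x i / ‖x i‖`, and `X` the Gram matrix of the `v i`.
Row norms concentrate around `√d`, so the columns of the matrix with rows `v i` are close to `V`,
and `⟨Π_V, X⟩` is nearly `n`. Hence `X` is an almost optimal degree-2 solution, and the task is to
extend it to degree 4 at small cost.

The Gaussian fourth moments `X i j * X k l + X i k * X j l + X i l * X j k` violate `x i ^ 2 = 1`:
for `k = i` they give `X j l + 2 * X i j * X i l`. Subtracting `2 * ∑ m, X i m * X j m * X k m * X l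
m` repairs this to leading order, because its `m = i` term is exactly the excess. Two small
parameters pay for the remaining errors: `η` inflates the Gaussian part, and `ρ = (1 + τ)⁻¹` shrinks
every degree-2 moment by `ρ` and every degree-4 moment by `ρ ^ 2`, which leaves slack of order `τ ^
2` on the diagonal.

Positivity has two sources. On tuples sharing indices, the discrepancies are positive semidefinite
up to errors absorbed by the diagonal slack (`sum_sharedKernel_nonneg`, `diagKernel_ge`). The
corrected kernel itself is controlled by `QuarticBound`, a Bessel-type inequality `∑ ⟨v_m v_mᵀ, A⟩²
≤ (1 + η) ‖A‖² + (η / 2) (tr A)²` for symmetric `A`. It holds because the centred tensors `v_m v_mᵀ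
- I / d` are nearly orthonormal: the matrix `Y` of the numbers `X i j ^ 2 - 1 / d` off the diagonal
has small operator norm (`quarticBound_gram`). This norm is bounded through `Y²`, whose diagonal is
small when all correlations are small and whose off-diagonal part is small in mean square. The mean
square reduces to closed walks of length four, each contracted by the reproducing identity of
degree-two spherical harmonics (`integral_centered_mul_centered`).

Markov's inequality shows that the required estimates hold with high probability for the Gaussian
matrix. Averaging over the orthogonal group carries this to any invariant law on the Grassmannian
(`gaussianRows_le_uniform`). -/

/-! ### The pseudomoments and their values on small sets. -/

/-- The hafnian of the restriction of `A` to a four-element set, written through power sums. -/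
noncomputable def hafnianFour {n : ℕ} (A : Matrix (Fin n) (Fin n) ℝ) (U : Finset (Fin n)) : ℝ :=
  ((∑ i ∈ U, ∑ j ∈ U, A i j) ^ 2 - 4 * ∑ i ∈ U, (∑ j ∈ U, A i j) ^ 2
    + 2 * ∑ i ∈ U, ∑ j ∈ U, A i j ^ 2) / 8

/-- The off-diagonal part of a matrix. -/
def offDiagPart {n : ℕ} (X : Matrix (Fin n) (Fin n) ℝ) : Matrix (Fin n) (Fin n) ℝ :=
  Matrix.of fun i j => if i = j then 0 else X i j

/-- The pseudomoment of the monomial `∏ i ∈ U, x i` attached to a correlation matrix `X`. -/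
noncomputable def pseudomoment {n : ℕ} (X : Matrix (Fin n) (Fin n) ℝ) (η ρ : ℝ)
    (U : Finset (Fin n)) : ℝ :=
  if U.card = 0 then 1
  else if U.card = 2 then ρ * ((∑ i ∈ U, ∑ j ∈ U, offDiagPart X i j) / 2)
  else if U.card = 4 then
    ρ ^ 2 * ((1 + η) * hafnianFour (offDiagPart X) U - 2 * ∑ m, ∏ i ∈ U, X i m)
  else 0

theorem pseudomoment_empty {n : ℕ} (X : Matrix (Fin n) (Fin n) ℝ) (η ρ : ℝ) :
    pseudomoment X η ρ ∅ = 1 := by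
  simp [pseudomoment]

theorem pseudomoment_of_odd {n : ℕ} (X : Matrix (Fin n) (Fin n) ℝ) (η ρ : ℝ)
    {U : Finset (Fin n)} (hU : Odd U.card) : pseudomoment X η ρ U = 0 := by
  have h0 : U.card ≠ 0 := by rintro h; rw [h] at hU; revert hU; decide
  have h2 : U.card ≠ 2 := by rintro h; rw [h] at hU; revert hU; decide
  have h4 : U.card ≠ 4 := by rintro h; rw [h] at hU; revert hU; decide
  simp [pseudomoment, h0, h2, h4]

theorem pseudomoment_pair {n : ℕ} {X : Matrix (Fin n) (Fin n) ℝ} (hX : ∀ i j, X i j = X j i)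
    (η ρ : ℝ) {i j : Fin n} (hij : i ≠ j) : pseudomoment X η ρ {i, j} = ρ * X i j := by
  have hc : ({i, j} : Finset (Fin n)).card = 2 := Finset.card_pair hij
  simp only [pseudomoment, hc]
  simp [Finset.sum_pair hij, offDiagPart, hij, hij.symm, hX j i]

theorem pseudomoment_four {n : ℕ} {X : Matrix (Fin n) (Fin n) ℝ} (hX : ∀ i j, X i j = X j i)
    (η ρ : ℝ) {i j k l : Fin n} (hij : i ≠ j) (hik : i ≠ k) (hil : i ≠ l) (hjk : j ≠ k)
    (hjl : j ≠ l) (hkl : k ≠ l) :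
    pseudomoment X η ρ {i, j, k, l} =
      ρ ^ 2 * ((1 + η) * (X i j * X k l + X i k * X j l + X i l * X j k)
        - 2 * ∑ m, X i m * X j m * X k m * X l m) := by
  have hi : i ∉ ({j, k, l} : Finset (Fin n)) := by simp [hij, hik, hil]
  have hj : j ∉ ({k, l} : Finset (Fin n)) := by simp [hjk, hjl]
  have hk : k ∉ ({l} : Finset (Fin n)) := by simp [hkl]
  have hc : ({i, j, k, l} : Finset (Fin n)).card = 4 := by
    rw [Finset.card_insert_of_notMem hi, Finset.card_insert_of_notMem hj,
      Finset.card_insert_of_notMem hk, Finset.card_singleton]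
  simp only [pseudomoment, hc]
  norm_num
  left
  congr 1
  · congr 1
    -- In the squared total each matching of the four points occurs 8 times; inclusion–exclusion
    -- over shared indices removes every product of two entries that meet.
    simp only [hafnianFour, Finset.sum_insert hi, Finset.sum_insert hj, Finset.sum_insert hk,
      Finset.sum_singleton, offDiagPart, Matrix.of_apply, if_neg hij, if_neg hik, if_neg hil,
      if_neg hjk, if_neg hjl, if_neg hkl, if_neg hij.symm, if_neg hik.symm, if_neg hil.symm,
      if_neg hjk.symm, if_neg hjl.symm, if_neg hkl.symm, if_true, hX j i, hX k i, hX l i, hX k j,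
      hX l j, hX l k]
    ring
  · refine congrArg (2 * ·) (Finset.sum_congr rfl fun m _ => ?_)
    rw [Finset.prod_insert hi, Finset.prod_insert hj, Finset.prod_insert hk,
      Finset.prod_singleton]
    ring

theorem symmDiff_pair_of_disjoint {α : Type*} [DecidableEq α] {i j k l : α} (hik : i ≠ k)
    (hil : i ≠ l) (hjk : j ≠ k) (hjl : j ≠ l) :
    symmDiff ({i, j} : Finset α) {k, l} = {i, j, k, l} := by
  ext x; simp only [Finset.mem_symmDiff, Finset.mem_insert, Finset.mem_singleton]; grind

theorem symmDiff_pair_of_common {α : Type*} [DecidableEq α] {i j l : α} (hij : i ≠ j)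
    (hil : i ≠ l) (hjl : j ≠ l) :
    symmDiff ({i, j} : Finset α) {i, l} = {j, l} := by
  ext x; simp only [Finset.mem_symmDiff, Finset.mem_insert, Finset.mem_singleton]; grind

theorem symmDiff_singletons {α : Type*} [DecidableEq α] {i j : α} (hij : i ≠ j) :
    symmDiff ({i} : Finset α) {j} = {i, j} := by
  ext x; simp only [Finset.mem_symmDiff, Finset.mem_insert, Finset.mem_singleton]; grind

theorem odd_card_symmDiff {α : Type*} [DecidableEq α] {S T : Finset α} (h : Odd (S.card + T.card)) :
    Odd (symmDiff S T).card := by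
  have h1 : (symmDiff S T).card = (S \ T).card + (T \ S).card := by
    rw [symmDiff_def, Finset.sup_eq_union, Finset.card_union_of_disjoint]
    exact disjoint_sdiff_sdiff
  have h2 := Finset.card_sdiff_add_card_inter S T
  have h3 := Finset.card_sdiff_add_card_inter T S
  rw [Finset.inter_comm T S] at h3
  rw [Nat.odd_iff] at h ⊢
  omega

/-! ### Kernel and discrepancies on the block of pairs. -/

/-- The four-point Gaussian-type moment with the quartic correction. -/
noncomputable def quarticKernel {n : ℕ} (X : Matrix (Fin n) (Fin n) ℝ) (η : ℝ)
    (i j k l : Fin n) : ℝ :=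
  (1 + η) * (X i j * X k l + X i k * X j l + X i l * X j k)
    - 2 * ∑ m, X i m * X j m * X k m * X l m

/-- The discrepancy between moments and `quarticKernel` on pairs sharing the index `i`. -/
noncomputable def sharedKernel {n : ℕ} (X : Matrix (Fin n) (Fin n) ℝ) (η τ : ℝ)
    (i j l : Fin n) : ℝ :=
  2 * (∑ m, if m = i then 0 else X i m ^ 2 * X j m * X l m) - 2 * η * (X i j * X i l)
    + (τ - η) * X j l

/-- The remaining discrepancy on the diagonal. -/
noncomputable def diagKernel {n : ℕ} (X : Matrix (Fin n) (Fin n) ℝ) (η τ : ℝ)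
    (i j : Fin n) : ℝ :=
  (1 + τ) ^ 2 - quarticKernel X η i j i j - sharedKernel X η τ i j j - sharedKernel X η τ j i i

theorem quarticKernel_swap_left {n : ℕ} {X : Matrix (Fin n) (Fin n) ℝ}
    (hX : ∀ i j, X i j = X j i) (η : ℝ) (i j k l : Fin n) :
    quarticKernel X η j i k l = quarticKernel X η i j k l := by
  unfold quarticKernel
  rw [hX j i]
  congr 1
  · ring
  · congr 1; exact Finset.sum_congr rfl fun m _ => by ring

theorem quarticKernel_swap_right {n : ℕ} {X : Matrix (Fin n) (Fin n) ℝ}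
    (hX : ∀ i j, X i j = X j i) (η : ℝ) (i j k l : Fin n) :
    quarticKernel X η i j l k = quarticKernel X η i j k l := by
  unfold quarticKernel
  rw [hX l k]
  congr 1
  · ring
  · congr 1; exact Finset.sum_congr rfl fun m _ => by ring

/-- The `m = i` term of the quartic sum is `X i j * X i l`; twice this cancels the two superfluous
Gaussian pairings. What is left over is `sharedKernel`. -/
theorem quarticKernel_add_sharedKernel {n : ℕ} {X : Matrix (Fin n) (Fin n) ℝ}
    (hX : ∀ i j, X i j = X j i) (h1 : ∀ i, X i i = 1) (η τ : ℝ) (i j l : Fin n) :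
    quarticKernel X η i j i l + sharedKernel X η τ i j l = (1 + τ) * X j l := by
  unfold quarticKernel sharedKernel
  have : ∑ m, X i m * X j m * X i m * X l m =
      X i j * X i l + ∑ m, if m = i then 0 else X i m ^ 2 * X j m * X l m := by
    rw [← Finset.add_sum_erase _ _ (Finset.mem_univ i), h1, hX j i, hX l i,
      ← Finset.add_sum_erase (a := i) _ (fun m => if m = i then (0 : ℝ) else _)
        (Finset.mem_univ i)]
    simp only [if_true, zero_add]
    congr 1
    · ring
    · refine Finset.sum_congr rfl fun m hm => ?_
      rw [if_neg (Finset.ne_of_mem_erase hm)]; ring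
  rw [this, h1, hX j i]
  ring

/-- A degree-2 moment `ρ * X j l` equals `ρ ^ 2 * ((1 + τ) * X j l)`, so all cases carry the common
factor `ρ ^ 2`. When the two pairs coincide, two shared terms are active at once and `diagKernel`
supplies the remainder. -/
theorem pseudomoment_symmDiff_pair {n : ℕ} {X : Matrix (Fin n) (Fin n) ℝ}
    (hX : ∀ i j, X i j = X j i) (h1 : ∀ i, X i i = 1) {η τ ρ : ℝ} (hρ : ρ * (1 + τ) = 1)
    {i j k l : Fin n} (hij : i ≠ j) (hkl : k ≠ l) :
    pseudomoment X η ρ (symmDiff {i, j} {k, l}) =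
      ρ ^ 2 * (quarticKernel X η i j k l
        + ((if i = k then sharedKernel X η τ i j l else 0)
          + (if i = l then sharedKernel X η τ i j k else 0)
          + (if j = k then sharedKernel X η τ j i l else 0)
          + (if j = l then sharedKernel X η τ j i k else 0)
          + (if i = k ∧ j = l then diagKernel X η τ i j else 0)
          + (if i = l ∧ j = k then diagKernel X η τ i j else 0))) := by
  have hpair : ∀ a b c : Fin n, a ≠ b → a ≠ c → b ≠ c → ∀ K : ℝ,
      K = quarticKernel X η a b a c + sharedKernel X η τ a b c →
      pseudomoment X η ρ {b, c} = ρ ^ 2 * K := by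
    intro a b c hab hac hbc K hK
    rw [hK, quarticKernel_add_sharedKernel hX h1, pseudomoment_pair hX _ _ hbc]
    linear_combination (-ρ * X b c) * hρ
  have hone : ∀ K : ℝ, K = (1 + τ) ^ 2 → (1 : ℝ) = ρ ^ 2 * K := by
    intro K hK
    rw [hK, ← mul_pow, hρ, one_pow]
  by_cases hik : i = k
  · subst hik
    by_cases hjl : j = l
    · subst hjl
      rw [symmDiff_self, Finset.bot_eq_empty, pseudomoment_empty]
      apply hone
      simp only [hij, hij.symm, diagKernel, if_true, if_false, and_self]
      ring
    · rw [symmDiff_pair_of_common hij hkl hjl]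
      apply hpair i j l hij hkl hjl
      simp [hkl, hij.symm, hjl]
  · by_cases hil : i = l
    · subst hil
      by_cases hjk : j = k
      · subst hjk
        rw [Finset.pair_comm j i, symmDiff_self, Finset.bot_eq_empty, pseudomoment_empty]
        apply hone
        simp only [hij, hij.symm, diagKernel, if_true, if_false, and_self]
        rw [quarticKernel_swap_right hX η i j i j]
        ring
      · rw [Finset.pair_comm k i, symmDiff_pair_of_common hij hkl.symm hjk]
        apply hpair i j k hij hkl.symm hjk
        rw [quarticKernel_swap_right hX η i j i k]
        simp [hik, hij.symm, hjk]
    · by_cases hjk : j = k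
      · subst hjk
        rw [Finset.pair_comm i j, symmDiff_pair_of_common hij.symm hkl hil]
        apply hpair j i l hij.symm hkl hil
        rw [quarticKernel_swap_left hX η j i j l]
        simp [hij, hil, hkl]
      · by_cases hjl : j = l
        · subst hjl
          rw [Finset.pair_comm i j, Finset.pair_comm k j,
            symmDiff_pair_of_common hij.symm hkl.symm hik]
          apply hpair j i k hij.symm hkl.symm hik
          rw [quarticKernel_swap_left hX η j i k j, quarticKernel_swap_right hX η j i j k]
          simp [hij, hik, hjk]
        · rw [symmDiff_pair_of_disjoint hik hil hjk hjl,
            pseudomoment_four hX _ _ hij hik hil hjk hjl hkl]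
          simp [hik, hil, hjk, hjl, quarticKernel]

/-- By `quarticKernel_add_sharedKernel` the first three terms leave `(1 + τ) ^ 2 - (1 + τ)`, and the
last shared term costs `τ - η` plus products of small correlations. The linear terms in `τ` cancel,
leaving `τ ^ 2`. -/
theorem diagKernel_ge {n : ℕ} {X : Matrix (Fin n) (Fin n) ℝ}
    (hX : ∀ i j, X i j = X j i) (h1 : ∀ i, X i i = 1) {η τ θ : ℝ} (hη : 0 ≤ η)
    (hθ : ∀ i j, i ≠ j → X i j ^ 2 ≤ θ) {i j : Fin n} (hij : i ≠ j) :
    τ ^ 2 - 2 * θ - 2 * n * θ ^ 2 ≤ diagKernel X η τ i j := by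
  have hθ0 : 0 ≤ θ := (sq_nonneg _).trans (hθ i j hij)
  have e1 := quarticKernel_add_sharedKernel hX h1 η τ i j j
  have e2 : sharedKernel X η τ j i i = 2 * (X i j ^ 2 +
      ∑ m, if m = j ∨ m = i then 0 else X j m ^ 2 * X i m ^ 2) - 2 * η * X i j ^ 2 + (τ - η) := by
    unfold sharedKernel
    have : (∑ m, if m = j then 0 else X j m ^ 2 * X i m * X i m) = X i j ^ 2 +
        ∑ m, if m = j ∨ m = i then 0 else X j m ^ 2 * X i m ^ 2 := by
      rw [← Finset.add_sum_erase _ _ (Finset.mem_univ i),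
        ← Finset.add_sum_erase (a := i) _ (fun m => if m = j ∨ m = i then (0 : ℝ) else _)
          (Finset.mem_univ i)]
      simp only [hij, if_false, h1, hX j i, or_true, if_true, zero_add, mul_one]
      congr 1
      refine Finset.sum_congr rfl fun m hm => ?_
      have := Finset.ne_of_mem_erase hm
      simp only [this, or_false]
      split_ifs <;> ring
    rw [this, h1, hX j i]
    ring
  have e3 : (∑ m, if m = j ∨ m = i then 0 else X j m ^ 2 * X i m ^ 2) ≤ n * θ ^ 2 := by
    calc _ ≤ ∑ _m : Fin n, θ ^ 2 := by
          refine Finset.sum_le_sum fun m _ => ?_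
          split_ifs with h
          · positivity
          · push Not at h
            rw [sq θ]
            exact mul_le_mul (hθ _ _ h.1.symm) (hθ _ _ h.2.symm) (sq_nonneg _) hθ0
      _ = n * θ ^ 2 := by simp
  have e4 := hθ i j hij
  unfold diagKernel
  have : (1 + τ) ^ 2 - quarticKernel X η i j i j - sharedKernel X η τ i j j =
      (1 + τ) ^ 2 - (1 + τ) := by rw [h1] at e1; linarith
  rw [this, e2]
  have : 0 ≤ η * X i j ^ 2 := by positivity
  nlinarith

theorem diagKernel_comm {n : ℕ} {X : Matrix (Fin n) (Fin n) ℝ}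
    (hX : ∀ i j, X i j = X j i) (η τ : ℝ) (i j : Fin n) :
    diagKernel X η τ j i = diagKernel X η τ i j := by
  unfold diagKernel
  rw [quarticKernel_swap_left hX η i j j i, quarticKernel_swap_right hX η i j i j]
  ring

theorem sum_quarticKernel {n : ℕ} (X : Matrix (Fin n) (Fin n) ℝ) (η : ℝ)
    (o : Fin n × Fin n → ℝ) :
    ∑ p, ∑ q, o p * o q * quarticKernel X η p.1 p.2 q.1 q.2 =
      (1 + η) * ((∑ p, o p * X p.1 p.2) ^ 2
        + ∑ p, ∑ q, o p * o q * (X p.1 q.1 * X p.2 q.2 + X p.1 q.2 * X p.2 q.1))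
      - 2 * ∑ m, (∑ p, o p * (X p.1 m * X p.2 m)) ^ 2 := by
  have e1 : (∑ p, o p * X p.1 p.2) ^ 2 = ∑ p, ∑ q, o p * o q * (X p.1 p.2 * X q.1 q.2) := by
    rw [sq, Finset.sum_mul_sum]
    exact Finset.sum_congr rfl fun p _ => Finset.sum_congr rfl fun q _ => by ring
  have e2 : ∑ m, (∑ p, o p * (X p.1 m * X p.2 m)) ^ 2 =
      ∑ p, ∑ q, o p * o q * ∑ m, X p.1 m * X p.2 m * X q.1 m * X q.2 m := by
    simp_rw [sq, Finset.sum_mul_sum, Finset.mul_sum]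
    rw [Finset.sum_comm]
    refine Finset.sum_congr rfl fun p _ => ?_
    rw [Finset.sum_comm]
    exact Finset.sum_congr rfl fun q _ => Finset.sum_congr rfl fun m _ => by ring
  rw [e1, e2, ← Finset.sum_add_distrib, Finset.mul_sum, Finset.mul_sum, ← Finset.sum_sub_distrib]
  refine Finset.sum_congr rfl fun p _ => ?_
  rw [← Finset.sum_add_distrib, Finset.mul_sum, Finset.mul_sum, ← Finset.sum_sub_distrib]
  refine Finset.sum_congr rfl fun q _ => ?_
  unfold quarticKernel
  ring

/-- Of the three parts of `sharedKernel`, the sum over `m ≠ i` is a sum of squares and `(τ - η) * X`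
is positive semidefinite. Only the rank-one part `-2 * η * X i j * X i l` is negative. Since `u i i
= 0`, Cauchy–Schwarz bounds it using off-diagonal entries of row `i` alone. -/
theorem sum_sharedKernel_nonneg {n : ℕ} {X : Matrix (Fin n) (Fin n) ℝ} (h0 : X.PosSemidef)
    {η τ θ : ℝ} (hη : 0 ≤ η) (hητ : η ≤ τ) (hθ0 : 0 ≤ θ)
    (hθ : ∀ i j, i ≠ j → X i j ^ 2 ≤ θ) (u : Fin n → Fin n → ℝ) (hu : ∀ i, u i i = 0)
    (i : Fin n) :
    -(2 * η * n * θ * ∑ j, u i j ^ 2) ≤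
      ∑ j, ∑ l, u i j * u i l * sharedKernel X η τ i j l := by
  have e : ∑ j, ∑ l, u i j * u i l * sharedKernel X η τ i j l =
      2 * (∑ m, if m = i then 0 else X i m ^ 2 * (∑ j, u i j * X j m) ^ 2)
      - 2 * η * (∑ j, u i j * X i j) ^ 2 + (τ - η) * ∑ j, ∑ l, u i j * u i l * X j l := by
    have e1 : (∑ j, u i j * X i j) ^ 2 = ∑ j, ∑ l, u i j * u i l * (X i j * X i l) := by
      rw [sq, Finset.sum_mul_sum]
      exact Finset.sum_congr rfl fun p _ => Finset.sum_congr rfl fun q _ => by ring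
    have e2 : (∑ m, if m = i then 0 else X i m ^ 2 * (∑ j, u i j * X j m) ^ 2) =
        ∑ j, ∑ l, u i j * u i l * ∑ m, if m = i then 0 else X i m ^ 2 * X j m * X l m := by
      have : ∀ m, (if m = i then 0 else X i m ^ 2 * (∑ j, u i j * X j m) ^ 2) =
          ∑ j, ∑ l, u i j * u i l * if m = i then 0 else X i m ^ 2 * X j m * X l m := by
        intro m
        split_ifs
        · simp
        · rw [sq (∑ j, _), Finset.sum_mul_sum, Finset.mul_sum]
          refine Finset.sum_congr rfl fun p _ => ?_
          rw [Finset.mul_sum]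
          exact Finset.sum_congr rfl fun q _ => by ring
      simp_rw [this, Finset.mul_sum]
      rw [Finset.sum_comm]
      refine Finset.sum_congr rfl fun p _ => ?_
      rw [Finset.sum_comm]
    rw [e1, e2, Finset.mul_sum, Finset.mul_sum, Finset.mul_sum, ← Finset.sum_sub_distrib,
      ← Finset.sum_add_distrib]
    refine Finset.sum_congr rfl fun p _ => ?_
    rw [Finset.mul_sum, Finset.mul_sum, Finset.mul_sum, ← Finset.sum_sub_distrib,
      ← Finset.sum_add_distrib]
    refine Finset.sum_congr rfl fun q _ => ?_
    unfold sharedKernel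
    ring
  have p1 : 0 ≤ ∑ m, if m = i then 0 else X i m ^ 2 * (∑ j, u i j * X j m) ^ 2 :=
    Finset.sum_nonneg fun m _ => by split_ifs <;> positivity
  have p2 : 0 ≤ ∑ j, ∑ l, u i j * u i l * X j l := by
    have := h0.dotProduct_mulVec_nonneg (u i)
    simp only [dotProduct, Matrix.mulVec, star_trivial, Finset.mul_sum] at this
    refine this.trans_eq (Finset.sum_congr rfl fun p _ => Finset.sum_congr rfl fun q _ => by ring)
  have p3 : (∑ j, u i j * X i j) ^ 2 ≤ n * θ * ∑ j, u i j ^ 2 := by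
    have : ∑ j, u i j * X i j = ∑ j, u i j * (if i = j then 0 else X i j) := by
      refine Finset.sum_congr rfl fun j _ => ?_
      split_ifs with h
      · rw [← h, hu]; ring
      · rfl
    rw [this]
    refine (Finset.sum_mul_sq_le_sq_mul_sq _ _ _).trans ?_
    rw [mul_comm]
    refine mul_le_mul_of_nonneg_right ?_ (Finset.sum_nonneg fun j _ => sq_nonneg _)
    calc _ ≤ ∑ _j : Fin n, θ := Finset.sum_le_sum fun j _ => by
            split_ifs with h
            · simpa using hθ0
            · exact hθ _ _ h
      _ = n * θ := by simp
  rw [e]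
  nlinarith [mul_nonneg (sub_nonneg.2 hητ) p2, mul_le_mul_of_nonneg_left p3 hη]

/-- The four ways in which ordered pairs share an index assemble into one form in the symmetrised
coefficients `o (i, j) + o (j, i)`. -/
theorem sum_pairDiscrepancy {n : ℕ} {X : Matrix (Fin n) (Fin n) ℝ}
    (hX : ∀ i j, X i j = X j i) (η τ : ℝ) (o : Fin n × Fin n → ℝ) :
    ∑ p : Fin n × Fin n, ∑ q : Fin n × Fin n, o p * o q *
      ((if p.1 = q.1 then sharedKernel X η τ p.1 p.2 q.2 else 0)
          + (if p.1 = q.2 then sharedKernel X η τ p.1 p.2 q.1 else 0)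
          + (if p.2 = q.1 then sharedKernel X η τ p.2 p.1 q.2 else 0)
          + (if p.2 = q.2 then sharedKernel X η τ p.2 p.1 q.1 else 0)
          + (if p.1 = q.1 ∧ p.2 = q.2 then diagKernel X η τ p.1 p.2 else 0)
          + (if p.1 = q.2 ∧ p.2 = q.1 then diagKernel X η τ p.1 p.2 else 0)) =
    ∑ i, ∑ j, ∑ l, (o (i, j) + o (j, i)) * (o (i, l) + o (l, i)) * sharedKernel X η τ i j l
      + ∑ i, ∑ j, (o (i, j) + o (j, i)) ^ 2 * (diagKernel X η τ i j / 2) := by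
  have t1 : ∑ p : Fin n × Fin n, ∑ q : Fin n × Fin n,
      o p * o q * (if p.1 = q.1 then sharedKernel X η τ p.1 p.2 q.2 else 0) =
      ∑ i, ∑ j, ∑ l, o (i, j) * o (i, l) * sharedKernel X η τ i j l := by
    simp only [Fintype.sum_prod_type]
    refine Finset.sum_congr rfl fun i _ => Finset.sum_congr rfl fun j _ => ?_
    rw [Finset.sum_comm]
    exact Finset.sum_congr rfl fun l _ => by simp
  have t2 : ∑ p : Fin n × Fin n, ∑ q : Fin n × Fin n,
      o p * o q * (if p.1 = q.2 then sharedKernel X η τ p.1 p.2 q.1 else 0) =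
      ∑ i, ∑ j, ∑ l, o (i, j) * o (l, i) * sharedKernel X η τ i j l := by
    simp only [Fintype.sum_prod_type]
    refine Finset.sum_congr rfl fun i _ => Finset.sum_congr rfl fun j _ => ?_
    exact Finset.sum_congr rfl fun l _ => by simp
  have t3 : ∑ p : Fin n × Fin n, ∑ q : Fin n × Fin n,
      o p * o q * (if p.2 = q.1 then sharedKernel X η τ p.2 p.1 q.2 else 0) =
      ∑ i, ∑ j, ∑ l, o (j, i) * o (i, l) * sharedKernel X η τ i j l := by
    simp only [Fintype.sum_prod_type]
    rw [Finset.sum_comm]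
    refine Finset.sum_congr rfl fun i _ => Finset.sum_congr rfl fun j _ => ?_
    rw [Finset.sum_comm]
    exact Finset.sum_congr rfl fun l _ => by simp
  have t4 : ∑ p : Fin n × Fin n, ∑ q : Fin n × Fin n,
      o p * o q * (if p.2 = q.2 then sharedKernel X η τ p.2 p.1 q.1 else 0) =
      ∑ i, ∑ j, ∑ l, o (j, i) * o (l, i) * sharedKernel X η τ i j l := by
    simp only [Fintype.sum_prod_type]
    rw [Finset.sum_comm]
    refine Finset.sum_congr rfl fun i _ => Finset.sum_congr rfl fun j _ => ?_
    exact Finset.sum_congr rfl fun l _ => by simp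
  have t5 : ∑ p : Fin n × Fin n, ∑ q : Fin n × Fin n,
      o p * o q * (if p.1 = q.1 ∧ p.2 = q.2 then diagKernel X η τ p.1 p.2 else 0) =
      ∑ i, ∑ j, o (i, j) * o (i, j) * diagKernel X η τ i j := by
    simp only [Fintype.sum_prod_type]
    refine Finset.sum_congr rfl fun i _ => Finset.sum_congr rfl fun j _ => ?_
    simp [ite_and]
  have t6 : ∑ p : Fin n × Fin n, ∑ q : Fin n × Fin n,
      o p * o q * (if p.1 = q.2 ∧ p.2 = q.1 then diagKernel X η τ p.1 p.2 else 0) =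
      ∑ i, ∑ j, o (i, j) * o (j, i) * diagKernel X η τ i j := by
    simp only [Fintype.sum_prod_type]
    refine Finset.sum_congr rfl fun i _ => Finset.sum_congr rfl fun j _ => ?_
    simp [ite_and]
  have t7 : ∑ i, ∑ j, o (i, j) * o (i, j) * diagKernel X η τ i j =
      ∑ i, ∑ j, o (j, i) * o (j, i) * diagKernel X η τ i j := by
    rw [Finset.sum_comm]
    exact Finset.sum_congr rfl fun i _ => Finset.sum_congr rfl fun j _ => by
      rw [diagKernel_comm hX]
  have t8 : ∑ i, ∑ j, (o (i, j) + o (j, i)) ^ 2 * (diagKernel X η τ i j / 2) =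
      ∑ i, ∑ j, o (i, j) * o (i, j) * diagKernel X η τ i j
        + ∑ i, ∑ j, o (i, j) * o (j, i) * diagKernel X η τ i j := by
    have : ∑ i, ∑ j, o (i, j) * o (i, j) * diagKernel X η τ i j =
        (∑ i, ∑ j, o (i, j) * o (i, j) * diagKernel X η τ i j
          + ∑ i, ∑ j, o (j, i) * o (j, i) * diagKernel X η τ i j) / 2 := by rw [← t7]; ring
    rw [this]
    simp only [← Finset.sum_add_distrib, Finset.sum_div]
    exact Finset.sum_congr rfl fun i _ => Finset.sum_congr rfl fun j _ => by ring
  have t9 : ∑ i, ∑ j, ∑ l, (o (i, j) + o (j, i)) * (o (i, l) + o (l, i)) *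
        sharedKernel X η τ i j l =
      ∑ i, ∑ j, ∑ l, o (i, j) * o (i, l) * sharedKernel X η τ i j l
      + ∑ i, ∑ j, ∑ l, o (i, j) * o (l, i) * sharedKernel X η τ i j l
      + ∑ i, ∑ j, ∑ l, o (j, i) * o (i, l) * sharedKernel X η τ i j l
      + ∑ i, ∑ j, ∑ l, o (j, i) * o (l, i) * sharedKernel X η τ i j l := by
    simp only [← Finset.sum_add_distrib]
    exact Finset.sum_congr rfl fun i _ => Finset.sum_congr rfl fun j _ =>
      Finset.sum_congr rfl fun l _ => by ring
  rw [t8, t9]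
  simp only [mul_add, Finset.sum_add_distrib, t1, t2, t3, t4, t5, t6]
  ring

/-! ### Positive semidefiniteness from the quartic condition. -/

/-- The quartic spectral condition on a correlation matrix which makes the degree-four extension
positive semidefinite. -/
def QuarticBound {n : ℕ} (X : Matrix (Fin n) (Fin n) ℝ) (η : ℝ) : Prop :=
  ∀ C : Fin n × Fin n → ℝ,
    ∑ m, (∑ p, C p * (X p.1 m * X p.2 m)) ^ 2 ≤
      (1 + η) / 2 * ∑ p, ∑ q, C p * C q * (X p.1 q.1 * X p.2 q.2 + X p.1 q.2 * X p.2 q.1)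
        + η / 2 * (∑ p, C p * X p.1 p.2) ^ 2

/-- This is the Schur complement inequality for the row of the empty set. In the Gaussian part the
squared trace term has coefficient `1 + η`; `QuarticBound` consumes `η` of it and all of the other
pairings, leaving exactly one square. The hypothesis on `τ ^ 2` lets the diagonal slack absorb the
negative shared part. -/
theorem sq_le_sum_pseudomoment_pairs {n : ℕ} {X : Matrix (Fin n) (Fin n) ℝ}
    (h0 : X.PosSemidef) (hX : ∀ i j, X i j = X j i) (h1 : ∀ i, X i i = 1) {η τ θ ρ : ℝ}
    (hρ : ρ * (1 + τ) = 1) (hη : 0 ≤ η) (hητ : η ≤ τ) (hθ0 : 0 ≤ θ)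
    (hθ : ∀ i j, i ≠ j → X i j ^ 2 ≤ θ) (hspec : QuarticBound X η)
    (hτ : 2 * θ + 2 * n * θ ^ 2 + 4 * η * n * θ ≤ τ ^ 2)
    (o : Fin n × Fin n → ℝ) (ho : ∀ i, o (i, i) = 0) :
    (ρ * ∑ p, o p * X p.1 p.2) ^ 2 ≤
      ∑ p : Fin n × Fin n, ∑ q : Fin n × Fin n,
        o p * o q * pseudomoment X η ρ (symmDiff {p.1, p.2} {q.1, q.2}) := by
  have e : ∑ p : Fin n × Fin n, ∑ q : Fin n × Fin n,
        o p * o q * pseudomoment X η ρ (symmDiff {p.1, p.2} {q.1, q.2}) =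
      ρ ^ 2 * (∑ p, ∑ q, o p * o q * quarticKernel X η p.1 p.2 q.1 q.2
        + ∑ p : Fin n × Fin n, ∑ q : Fin n × Fin n, o p * o q *
      ((if p.1 = q.1 then sharedKernel X η τ p.1 p.2 q.2 else 0)
          + (if p.1 = q.2 then sharedKernel X η τ p.1 p.2 q.1 else 0)
          + (if p.2 = q.1 then sharedKernel X η τ p.2 p.1 q.2 else 0)
          + (if p.2 = q.2 then sharedKernel X η τ p.2 p.1 q.1 else 0)
          + (if p.1 = q.1 ∧ p.2 = q.2 then diagKernel X η τ p.1 p.2 else 0)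
          + (if p.1 = q.2 ∧ p.2 = q.1 then diagKernel X η τ p.1 p.2 else 0))) := by
    simp only [← Finset.sum_add_distrib, Finset.mul_sum]
    refine Finset.sum_congr rfl fun p _ => Finset.sum_congr rfl fun q _ => ?_
    by_cases hp : p.1 = p.2
    · have : o p = 0 := by rw [← ho p.1]; congr 1; exact Prod.ext rfl hp.symm
      simp [this]
    by_cases hq : q.1 = q.2
    · have : o q = 0 := by rw [← ho q.1]; congr 1; exact Prod.ext rfl hq.symm
      simp [this]
    rw [pseudomoment_symmDiff_pair hX h1 hρ hp hq]
    ring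
  rw [e, mul_pow]
  refine mul_le_mul_of_nonneg_left ?_ (sq_nonneg ρ)
  rw [sum_quarticKernel, sum_pairDiscrepancy hX]
  have s1 := hspec o
  have s2 : 0 ≤ ∑ i, ∑ j, ∑ l, (o (i, j) + o (j, i)) * (o (i, l) + o (l, i)) *
        sharedKernel X η τ i j l
      + ∑ i, ∑ j, (o (i, j) + o (j, i)) ^ 2 * (diagKernel X η τ i j / 2) := by
    rw [← Finset.sum_add_distrib]
    refine Finset.sum_nonneg fun i _ => ?_
    have b1 := sum_sharedKernel_nonneg h0 hη hητ hθ0 hθ (fun i j => o (i, j) + o (j, i))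
      (fun i => by simp [ho]) i
    have b2 : 2 * η * n * θ * ∑ j, (o (i, j) + o (j, i)) ^ 2 ≤
        ∑ j, (o (i, j) + o (j, i)) ^ 2 * (diagKernel X η τ i j / 2) := by
      rw [Finset.mul_sum]
      refine Finset.sum_le_sum fun j _ => ?_
      by_cases hij : i = j
      · subst hij; simp [ho]
      · have := diagKernel_ge hX h1 (τ := τ) hη hθ hij
        rw [mul_comm]
        refine mul_le_mul_of_nonneg_left ?_ (sq_nonneg _)
        linarith
    linarith
  linarith

/-- `none` encodes the empty set and `(i, i)` the singleton `{i}`. Odd moments vanish, so singletons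
decouple from even sets; their block is `ρ * X + (1 - ρ) * I`. The even block follows by completing
the square in `c none`. -/
theorem posSemidef_pseudomoment_pairs {n : ℕ} {X : Matrix (Fin n) (Fin n) ℝ}
    (h0 : X.PosSemidef) (h1 : ∀ i, X i i = 1) {η τ θ : ℝ}
    (hη : 0 ≤ η) (hητ : η ≤ τ) (hθ0 : 0 ≤ θ)
    (hθ : ∀ i j, i ≠ j → X i j ^ 2 ≤ θ) (hspec : QuarticBound X η)
    (hτ : 2 * θ + 2 * n * θ ^ 2 + 4 * η * n * θ ≤ τ ^ 2) :
    (Matrix.of fun p q : Option (Fin n × Fin n) =>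
      pseudomoment X η (1 + τ)⁻¹ (symmDiff (p.elim ∅ fun p => {p.1, p.2})
        (q.elim ∅ fun q => {q.1, q.2}))).PosSemidef := by
  have hX : ∀ i j, X i j = X j i := fun i j => by
    have := h0.isHermitian.apply j i; simpa using this
  have hρ : (1 + τ)⁻¹ * (1 + τ) = 1 := inv_mul_cancel₀ (by linarith)
  set ρ := (1 + τ)⁻¹ with hρdef
  have hρ0 : 0 < ρ := by rw [hρdef]; exact inv_pos.2 (by linarith)
  have hρ1 : ρ ≤ 1 := by rw [hρdef]; exact inv_le_one_of_one_le₀ (by linarith)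
  refine Matrix.PosSemidef.of_dotProduct_mulVec_nonneg ?_ fun c => ?_
  · ext p q; simp [symmDiff_comm]
  simp only [dotProduct, Matrix.mulVec, star_trivial, Fintype.sum_option, Matrix.of_apply,
    Option.elim_none, Option.elim_some, symmDiff_self, Finset.bot_eq_empty, pseudomoment_empty]
  have z1 : ∀ s : Finset (Fin n), symmDiff ∅ s = s := bot_symmDiff
  have z2 : ∀ s : Finset (Fin n), symmDiff s ∅ = s := symmDiff_bot
  simp only [z1, z2]
  set o : Fin n × Fin n → ℝ := fun p => if p.1 = p.2 then 0 else c (some p) with ho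
  set b : Fin n → ℝ := fun i => c (some (i, i)) with hb
  have l1 : ∑ p : Fin n × Fin n, pseudomoment X η ρ {p.1, p.2} * c (some p) =
      ρ * ∑ p, o p * X p.1 p.2 := by
    rw [Finset.mul_sum]
    refine Finset.sum_congr rfl fun p _ => ?_
    simp only [ho]
    split_ifs with h
    · rw [← h, Finset.pair_eq_singleton, pseudomoment_of_odd]
      · ring
      · simp
    · rw [pseudomoment_pair hX _ _ h]; ring
  have l2 : ∑ p : Fin n × Fin n, ∑ q : Fin n × Fin n,
        c (some p) * c (some q) * pseudomoment X η ρ (symmDiff {p.1, p.2} {q.1, q.2}) =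
      ∑ p : Fin n × Fin n, ∑ q : Fin n × Fin n,
        o p * o q * pseudomoment X η ρ (symmDiff {p.1, p.2} {q.1, q.2})
      + ∑ i, ∑ k, b i * b k * pseudomoment X η ρ (symmDiff {i} {k}) := by
    have : ∑ i, ∑ k, b i * b k * pseudomoment X η ρ (symmDiff {i} {k}) =
        ∑ p : Fin n × Fin n, ∑ q : Fin n × Fin n, if p.1 = p.2 then if q.1 = q.2 then
          c (some p) * c (some q) * pseudomoment X η ρ (symmDiff {p.1, p.2} {q.1, q.2})
          else 0 else 0 := by
      simp only [Fintype.sum_prod_type]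
      simp [hb]
    rw [this, ← Finset.sum_add_distrib]
    refine Finset.sum_congr rfl fun p _ => ?_
    rw [← Finset.sum_add_distrib]
    refine Finset.sum_congr rfl fun q _ => ?_
    simp only [ho]
    split_ifs with hp hq hq
    · ring
    · rw [pseudomoment_of_odd]
      · ring
      · apply odd_card_symmDiff
        rw [← hp, Finset.pair_eq_singleton, Finset.card_singleton, Finset.card_pair hq]; decide
    · rw [pseudomoment_of_odd]
      · ring
      · apply odd_card_symmDiff
        rw [← hq, Finset.pair_eq_singleton, Finset.card_singleton, Finset.card_pair hp]; decide
    · ring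
  have l3 : 0 ≤ ∑ i, ∑ k, b i * b k * pseudomoment X η ρ (symmDiff {i} {k}) := by
    have e : ∀ i k, b i * b k * pseudomoment X η ρ (symmDiff {i} {k}) =
        ρ * (b i * (X i k * b k)) + if i = k then (1 - ρ) * b i ^ 2 else 0 := by
      intro i k
      split_ifs with h
      · subst h
        rw [symmDiff_self, Finset.bot_eq_empty, pseudomoment_empty, h1]; ring
      · rw [symmDiff_singletons h, pseudomoment_pair hX _ _ h]; ring
    simp only [e, Finset.sum_add_distrib, ← Finset.mul_sum]
    have p2 := h0.dotProduct_mulVec_nonneg b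
    simp only [dotProduct, Matrix.mulVec, star_trivial] at p2
    have p3 : 0 ≤ ∑ i, ∑ k, if i = k then (1 - ρ) * b i ^ 2 else 0 :=
      Finset.sum_nonneg fun i _ => Finset.sum_nonneg fun k _ => by
        split_ifs
        · exact mul_nonneg (by linarith) (sq_nonneg _)
        · rfl
    have := mul_nonneg hρ0.le p2
    linarith
  have l4 := sq_le_sum_pseudomoment_pairs h0 hX h1 hρ hη hητ hθ0 hθ hspec hτ o
    (fun i => by simp [ho])
  have l5 : ∑ p : Fin n × Fin n, c (some p) * (pseudomoment X η ρ {p.1, p.2} * c none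
      + ∑ q : Fin n × Fin n, pseudomoment X η ρ (symmDiff {p.1, p.2} {q.1, q.2}) * c (some q)) =
      c none * ∑ p : Fin n × Fin n, pseudomoment X η ρ {p.1, p.2} * c (some p)
      + ∑ p : Fin n × Fin n, ∑ q : Fin n × Fin n,
        c (some p) * c (some q) * pseudomoment X η ρ (symmDiff {p.1, p.2} {q.1, q.2}) := by
    rw [Finset.mul_sum, ← Finset.sum_add_distrib]
    refine Finset.sum_congr rfl fun p _ => ?_
    rw [mul_add, Finset.mul_sum]
    congr 1
    · ring
    · exact Finset.sum_congr rfl fun q _ => by ring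
  rw [l5, l2, l1]
  nlinarith [sq_nonneg (c none + ρ * ∑ p, o p * X p.1 p.2)]

theorem exists_isSoS4_of_quarticBound {n : ℕ} {X : Matrix (Fin n) (Fin n) ℝ}
    (h0 : X.PosSemidef) (h1 : ∀ i, X i i = 1) {η τ θ : ℝ}
    (hη : 0 ≤ η) (hητ : η ≤ τ) (hθ0 : 0 ≤ θ)
    (hθ : ∀ i j, i ≠ j → X i j ^ 2 ≤ θ) (hspec : QuarticBound X η)
    (hτ : 2 * θ + 2 * n * θ ^ 2 + 4 * η * n * θ ≤ τ ^ 2) :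
    ∃ M : Matrix (SmallSet n) (SmallSet n) ℝ, IsSoS4 M ∧
      ∀ i j, M (SmallSet.single i) (SmallSet.single j) =
        (1 + τ)⁻¹ * X i j + if i = j then 1 - (1 + τ)⁻¹ else 0 := by
  have hX : ∀ i j, X i j = X j i := fun i j => by
    have := h0.isHermitian.apply j i; simpa using this
  -- Each small set has a code among ordered pairs; choosing one turns the moment matrix into a
  -- submatrix of the one indexed by codes.
  have hsec : ∀ S : SmallSet n, ∃ p : Option (Fin n × Fin n),
      (p.elim ∅ fun p => {p.1, p.2}) = S.1 := by
    rintro ⟨S, hS⟩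
    have : S.card = 0 ∨ S.card = 1 ∨ S.card = 2 := by omega
    rcases this with h | h | h
    · exact ⟨none, by simpa using (Finset.card_eq_zero.1 h).symm⟩
    · obtain ⟨a, rfl⟩ := Finset.card_eq_one.1 h
      exact ⟨some (a, a), by simp⟩
    · obtain ⟨a, b, -, rfl⟩ := Finset.card_eq_two.1 h
      exact ⟨some (a, b), by simp⟩
  choose e he using hsec
  refine ⟨Matrix.of fun S T => pseudomoment X η (1 + τ)⁻¹ (symmDiff S.1 T.1), ?_, fun i j => ?_⟩
  · refine ⟨fun S T S' T' h => by simp [h], ?_, ?_⟩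
    · simp [SmallSet.empty, pseudomoment_empty]
    · convert (posSemidef_pseudomoment_pairs h0 h1 hη hητ hθ0 hθ hspec hτ).submatrix e using 1
      ext S T
      simp [he]
  · simp only [SmallSet.single, Matrix.of_apply]
    split_ifs with h
    · subst h
      rw [symmDiff_self, Finset.bot_eq_empty, pseudomoment_empty, h1]; ring
    · rw [symmDiff_singletons h, pseudomoment_pair hX _ _ h]; ring

/-! ### The quartic condition for Gram matrices of unit vectors. -/

/-- Cauchy–Schwarz gives `bᵀ Y b ≤ ‖b‖ ‖Y b‖`, and `‖Y b‖² = bᵀ Y² b`. The diagonal of `Y²` is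
bounded entrywise by `r`, its off-diagonal part in Frobenius norm by `f`. -/
theorem quadForm_le_of_sq {n : ℕ} (Y : Matrix (Fin n) (Fin n) ℝ) (hY : ∀ i j, Y i j = Y j i)
    {r f lam : ℝ} (hlam : 0 ≤ lam) (hf : 0 ≤ f) (hr : ∀ i, ∑ j, Y i j ^ 2 ≤ r)
    (hoff : ∑ i, ∑ k, (if i = k then 0 else ∑ j, Y i j * Y j k) ^ 2 ≤ f ^ 2)
    (hl : r + f ≤ lam ^ 2) (b : Fin n → ℝ) :
    ∑ i, ∑ j, b i * b j * Y i j ≤ lam * ∑ i, b i ^ 2 := by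
  set B := ∑ i, b i ^ 2 with hB
  have hB0 : 0 ≤ B := Finset.sum_nonneg fun i _ => sq_nonneg _
  have e1 : ∑ i, ∑ j, b i * b j * Y i j = ∑ i, b i * ∑ j, Y i j * b j := by
    refine Finset.sum_congr rfl fun i _ => ?_
    rw [Finset.mul_sum]
    exact Finset.sum_congr rfl fun j _ => by ring
  have e2 : ∑ i, (∑ j, Y i j * b j) ^ 2 = ∑ i, ∑ k, b i * b k * ∑ j, Y i j * Y j k := by
    have : ∀ j, (∑ i, Y j i * b i) ^ 2 = ∑ i, ∑ k, b i * b k * (Y i j * Y j k) := fun j => by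
      rw [sq, Finset.sum_mul_sum]
      refine Finset.sum_congr rfl fun i _ => Finset.sum_congr rfl fun k _ => ?_
      rw [hY j i]; ring
    simp_rw [this, Finset.mul_sum]
    rw [Finset.sum_comm]
    refine Finset.sum_congr rfl fun i _ => ?_
    rw [Finset.sum_comm]
  have e3 : ∑ i, ∑ k, b i * b k * ∑ j, Y i j * Y j k =
      ∑ i, b i ^ 2 * (∑ j, Y i j ^ 2) +
      ∑ i, ∑ k, b i * b k * (if i = k then 0 else ∑ j, Y i j * Y j k) := by
    rw [← Finset.sum_add_distrib]
    refine Finset.sum_congr rfl fun i _ => ?_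
    rw [← Finset.add_sum_erase _ _ (Finset.mem_univ i),
      ← Finset.add_sum_erase (a := i) _ (fun k => b i * b k * if i = k then (0 : ℝ) else _)
        (Finset.mem_univ i), if_pos rfl, mul_zero, zero_add]
    congr 1
    · rw [sq]; congr 1
      exact Finset.sum_congr rfl fun j _ => by rw [hY j i, sq]
    · refine Finset.sum_congr rfl fun k hk => ?_
      rw [if_neg (Finset.ne_of_mem_erase hk).symm]
  have e4 : ∑ i, b i ^ 2 * (∑ j, Y i j ^ 2) ≤ r * B := by
    rw [hB, Finset.mul_sum]
    refine Finset.sum_le_sum fun i _ => ?_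
    rw [mul_comm]
    exact mul_le_mul_of_nonneg_right (hr i) (sq_nonneg _)
  have e5 : ∑ i, ∑ k, b i * b k * (if i = k then 0 else ∑ j, Y i j * Y j k) ≤ f * B := by
    apply le_of_sq_le_sq ?_ (mul_nonneg hf hB0)
    have := Finset.sum_mul_sq_le_sq_mul_sq (Finset.univ : Finset (Fin n × Fin n))
      (fun p => b p.1 * b p.2) (fun p => if p.1 = p.2 then 0 else ∑ j, Y p.1 j * Y j p.2)
    simp only [Fintype.sum_prod_type] at this
    refine this.trans ?_
    have h2 : ∑ i, ∑ k, (b i * b k) ^ 2 = B ^ 2 := by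
      rw [sq B, hB, Finset.sum_mul_sum]
      exact Finset.sum_congr rfl fun i _ => Finset.sum_congr rfl fun k _ => by ring
    rw [h2, mul_pow, mul_comm]
    exact mul_le_mul_of_nonneg_right hoff (sq_nonneg _)
  have e6 : ∑ i, (∑ j, Y i j * b j) ^ 2 ≤ lam ^ 2 * B := by
    rw [e2, e3]
    nlinarith
  rw [e1]
  apply le_of_sq_le_sq ?_ (mul_nonneg hlam hB0)
  refine (Finset.sum_mul_sq_le_sq_mul_sq _ _ _).trans ?_
  rw [← hB]
  nlinarith [mul_le_mul_of_nonneg_left e6 hB0]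

/-- The centred squared correlations of unit vectors in dimension `d`. -/
noncomputable def centeredSq {n d : ℕ} (v : Fin n → EuclideanSpace ℝ (Fin d)) :
    Matrix (Fin n) (Fin n) ℝ :=
  Matrix.of fun i j => if i = j then 0 else inner ℝ (v i) (v j) ^ 2 - 1 / (d : ℝ)

/-- An operator and its adjoint have the same norm: the hypothesis bounds the synthesis map `b ↦ ∑ b
m • s m`, the conclusion the analysis map. Testing the hypothesis on `b m = ⟨s m, A⟩` suffices. -/
theorem sum_inner_sq_le_of_gram_le {n : ℕ} {H : Type*} [NormedAddCommGroup H]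
    [InnerProductSpace ℝ H] (s : Fin n → H) {K : ℝ} (hK : 0 ≤ K)
    (hs : ∀ b : Fin n → ℝ, ∑ i, ∑ j, b i * b j * inner ℝ (s i) (s j) ≤ K * ∑ i, b i ^ 2)
    (A : H) : ∑ m, inner ℝ (s m) A ^ 2 ≤ K * ‖A‖ ^ 2 := by
  set β : Fin n → ℝ := fun m => inner ℝ (s m) A with hβ
  have hβ0 : 0 ≤ ∑ m, β m ^ 2 := Finset.sum_nonneg fun i _ => sq_nonneg _
  have g1 : ‖∑ m, β m • s m‖ ^ 2 ≤ K * ∑ m, β m ^ 2 := by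
    refine le_of_eq_of_le ?_ (hs β)
    rw [← real_inner_self_eq_norm_sq, sum_inner]
    refine Finset.sum_congr rfl fun i _ => ?_
    rw [inner_sum]
    refine Finset.sum_congr rfl fun j _ => ?_
    rw [real_inner_smul_left, real_inner_smul_right]; ring
  have g2 : ∑ m, β m ^ 2 = inner ℝ (∑ m, β m • s m) A := by
    simp only [sum_inner, real_inner_smul_left, sq, hβ]
  have h1 : (∑ m, β m ^ 2) ^ 2 ≤ (K * ∑ m, β m ^ 2) * ‖A‖ ^ 2 := by
    have := abs_real_inner_le_norm (∑ m, β m • s m) A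
    rw [← g2, abs_of_nonneg hβ0] at this
    calc (∑ m, β m ^ 2) ^ 2 ≤ (‖∑ m, β m • s m‖ * ‖A‖) ^ 2 := by gcongr
      _ = ‖∑ m, β m • s m‖ ^ 2 * ‖A‖ ^ 2 := by rw [mul_pow]
      _ ≤ _ := mul_le_mul_of_nonneg_right g1 (by positivity)
  rcases hβ0.eq_or_lt with h | h
  · change ∑ m, β m ^ 2 ≤ _
    rw [← h]; positivity
  · change ∑ m, β m ^ 2 ≤ _
    nlinarith

/-- The rank-one matrix `x yᵀ` as an element of a Euclidean space. -/
noncomputable def outer {d : ℕ} (x y : EuclideanSpace ℝ (Fin d)) :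
    EuclideanSpace ℝ (Fin d × Fin d) :=
  WithLp.toLp 2 fun p => x p.1 * y p.2

/-- The identity matrix as an element of a Euclidean space. -/
noncomputable def identityVector (d : ℕ) : EuclideanSpace ℝ (Fin d × Fin d) :=
  WithLp.toLp 2 fun p => if p.1 = p.2 then 1 else 0

theorem inner_outer {d : ℕ} (x y x' y' : EuclideanSpace ℝ (Fin d)) :
    inner ℝ (outer x y) (outer x' y') = inner ℝ x x' * inner ℝ y y' := by
  simp only [outer, PiLp.inner_apply, Fintype.sum_prod_type, Finset.sum_mul_sum,
    RCLike.inner_apply, conj_trivial]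
  exact Finset.sum_congr rfl fun i _ => Finset.sum_congr rfl fun j _ => by ring

theorem inner_identityVector_outer {d : ℕ} (x y : EuclideanSpace ℝ (Fin d)) :
    inner ℝ (identityVector d) (outer x y) = inner ℝ x y := by
  simp [outer, identityVector, PiLp.inner_apply, Fintype.sum_prod_type, mul_comm]

theorem inner_identityVector_self (d : ℕ) :
    inner ℝ (identityVector d) (identityVector d) = (d : ℝ) := by
  simp only [identityVector, PiLp.inner_apply, Fintype.sum_prod_type]
  simp

/-- Take `s m = v_m v_mᵀ - I / d` and let `A` be the symmetrisation of `∑ C p v_{p.1} v_{p.2}ᵀ`. The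
trace of `A` produces the term divided by `d`. -/
theorem exists_centered_tensors {n d : ℕ} (hd : 0 < d) (v : Fin n → EuclideanSpace ℝ (Fin d))
    (hv : ∀ i, ‖v i‖ = 1) (C : Fin n × Fin n → ℝ) :
    ∃ (s : Fin n → EuclideanSpace ℝ (Fin d × Fin d)) (A : EuclideanSpace ℝ (Fin d × Fin d)),
      (∀ i j, inner ℝ (s i) (s j) = inner ℝ (v i) (v j) ^ 2 - 1 / (d : ℝ)) ∧
      (∀ m, inner ℝ (s m) A = ∑ p, C p * (inner ℝ (v p.1) (v m) * inner ℝ (v p.2) (v m)) -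
        (∑ p, C p * inner ℝ (v p.1) (v p.2)) / d) ∧
      ‖A‖ ^ 2 = (∑ p, ∑ q, C p * C q * (inner ℝ (v p.1) (v q.1) * inner ℝ (v p.2) (v q.2)
        + inner ℝ (v p.1) (v q.2) * inner ℝ (v p.2) (v q.1))) / 2 := by
  have hd' : (d : ℝ) ≠ 0 := by positivity
  have hw' : ∀ x y : EuclideanSpace ℝ (Fin d),
      inner ℝ (outer x y) (identityVector d) = inner ℝ x y := fun x y => by
    rw [← inner_identityVector_outer x y]; exact real_inner_comm _ _
  have hvv : ∀ i, inner ℝ (v i) (v i) = (1 : ℝ) := fun i => by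
    rw [real_inner_self_eq_norm_sq, hv]; norm_num
  refine ⟨fun m => outer (v m) (v m) - (1 / (d : ℝ)) • identityVector d,
    ∑ p : Fin n × Fin n, (C p / 2) • (outer (v p.1) (v p.2) + outer (v p.2) (v p.1)), ?_, ?_, ?_⟩
  · intro i j
    simp only [inner_sub_left, inner_sub_right, real_inner_smul_left, real_inner_smul_right,
      inner_identityVector_outer,
      hw', inner_identityVector_self, inner_outer, hvv]
    field_simp
    ring
  · intro m
    simp only [inner_sum, real_inner_smul_left, real_inner_smul_right, inner_sub_left,
      inner_add_right, inner_outer, Finset.sum_div, inner_identityVector_outer]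
    rw [← Finset.sum_sub_distrib]
    refine Finset.sum_congr rfl fun p _ => ?_
    rw [real_inner_comm (v m) (v p.1), real_inner_comm (v m) (v p.2),
      real_inner_comm (v p.1) (v p.2)]
    ring
  · rw [← real_inner_self_eq_norm_sq]
    simp only [sum_inner, inner_sum, real_inner_smul_left, real_inner_smul_right, inner_add_left,
      inner_add_right, inner_outer, Finset.sum_div]
    refine Finset.sum_congr rfl fun p _ => Finset.sum_congr rfl fun q _ => ?_
    rw [real_inner_comm (v p.1) (v q.1), real_inner_comm (v p.1) (v q.2),
      real_inner_comm (v p.2) (v q.1), real_inner_comm (v p.2) (v q.2)]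
    ring

/-- The Gram matrix of the `s m` is at most `1 + η / 3`. Restoring the trace adds `T / d` to each
coefficient; its total contribution is of order `n / d ^ 2` times `T ^ 2`, which `hdn` places inside
the trace term of the bound. -/
theorem quarticBound_gram {n d : ℕ} (hd : 0 < d) (v : Fin n → EuclideanSpace ℝ (Fin d))
    (hv : ∀ i, ‖v i‖ = 1) {η : ℝ} (hη : 0 < η) (hη1 : η ≤ 1)
    (hdn : (1 + 3 / η) * (n / (d : ℝ) ^ 2) ≤ η / 2)
    (hq : ∀ b : Fin n → ℝ, ∑ i, ∑ j, b i * b j * centeredSq v i j ≤ η / 3 * ∑ i, b i ^ 2) :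
    QuarticBound (Matrix.gram ℝ v) η := by
  intro C
  have hd' : (d : ℝ) ≠ 0 := by positivity
  obtain ⟨s, A, hss, hsA, hAA⟩ :=
    exists_centered_tensors hd v hv C
  have hvv : ∀ i, inner ℝ (v i) (v i) = (1 : ℝ) := fun i => by
    rw [real_inner_self_eq_norm_sq, hv]; norm_num
  simp only [Matrix.gram_apply]
  set T : ℝ := ∑ p, C p * inner ℝ (v p.1) (v p.2) with hT
  set Q : ℝ := ∑ p, ∑ q, C p * C q * (inner ℝ (v p.1) (v q.1) * inner ℝ (v p.2) (v q.2)
    + inner ℝ (v p.1) (v q.2) * inner ℝ (v p.2) (v q.1)) with hQ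
  have g3 : ∑ m, inner ℝ (s m) A ^ 2 ≤ (1 + η / 3) * (Q / 2) := by
    rw [← hAA]
    refine sum_inner_sq_le_of_gram_le s (by positivity) (fun b => ?_) A
    have e1 : ∀ i j, b i * b j * inner ℝ (s i) (s j) = b i * b j * centeredSq v i j +
        if i = j then (1 - 1 / (d : ℝ)) * b i ^ 2 else 0 := fun i j => by
      rw [hss]
      simp only [centeredSq, Matrix.of_apply]
      split_ifs with h
      · subst h; rw [hvv]; ring
      · ring
    simp only [e1, Finset.sum_add_distrib, Finset.sum_ite_eq, Finset.mem_univ, if_true,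
      ← Finset.mul_sum]
    have h3 : 0 ≤ 1 / (d : ℝ) * ∑ m, b m ^ 2 :=
      mul_nonneg (by positivity) (Finset.sum_nonneg fun i _ => sq_nonneg _)
    linarith [hq b]
  have hQ0 : 0 ≤ Q := by
    have : 0 ≤ Q / 2 := hAA ▸ sq_nonneg _
    linarith
  set β : Fin n → ℝ := fun m => inner ℝ (s m) A with hβ
  have g4 : ∀ m, (∑ p, C p * (inner ℝ (v p.1) (v m) * inner ℝ (v p.2) (v m))) ^ 2 ≤
      (1 + η / 3) * β m ^ 2 + (1 + 3 / η) * (T / d) ^ 2 := fun m => by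
    have : ∑ p, C p * (inner ℝ (v p.1) (v m) * inner ℝ (v p.2) (v m)) = β m + T / d := by
      simp only [hβ, hsA]; ring
    rw [this]
    -- Weighted AM–GM with weight `η / 3`, so that the main coefficient only grows to `(1 + η / 3) ^
    -- 2 ≤ 1 + η`.
    have h2 : 2 * (β m * (T / d)) ≤ η / 3 * β m ^ 2 + 3 / η * (T / d) ^ 2 := by
      have h5 : 0 ≤ 3 / η * (η / 3 * β m - T / d) ^ 2 := by positivity
      have e : 3 / η * (η / 3 * β m - T / d) ^ 2 = η / 3 * β m ^ 2 + 3 / η * (T / d) ^ 2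
        - 2 * (β m * (T / d)) := by field_simp; ring
      linarith
    linarith
  calc ∑ m, (∑ p, C p * (inner ℝ (v p.1) (v m) * inner ℝ (v p.2) (v m))) ^ 2
      ≤ ∑ m, ((1 + η / 3) * β m ^ 2 + (1 + 3 / η) * (T / d) ^ 2) :=
        Finset.sum_le_sum fun m _ => g4 m
    _ = (1 + η / 3) * ∑ m, β m ^ 2 + (1 + 3 / η) * (n / (d : ℝ) ^ 2) * T ^ 2 := by
        rw [Finset.sum_add_distrib, ← Finset.mul_sum]
        simp only [Finset.sum_const, Finset.card_univ, Fintype.card_fin, nsmul_eq_mul]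
        field_simp
    _ ≤ (1 + η / 3) * ((1 + η / 3) * (Q / 2)) + η / 2 * T ^ 2 := by
        gcongr
    _ ≤ (1 + η) / 2 * Q + η / 2 * T ^ 2 := by
        have : (1 + η / 3) * (1 + η / 3) ≤ 1 + η := by nlinarith
        nlinarith

/-! ### Lower bound for the value through approximation by vectors of the subspace. -/

/-- The inner product is `‖c‖²` minus the squared distance from `c` to `V`, and that distance is at
most `‖c - w‖`. -/
theorem real_inner_starProjection_ge {E : Type*} [NormedAddCommGroup E] [InnerProductSpace ℝ E]
    (V : Submodule ℝ E) [V.HasOrthogonalProjection] (c : E) {w : E} (hw : w ∈ V) :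
    ‖c‖ ^ 2 - ‖c - w‖ ^ 2 ≤ inner ℝ c (V.starProjection c) := by
  have h1 := V.starProjection_inner_eq_zero c w hw
  have h2 := V.starProjection_inner_eq_zero c _ (V.starProjection_apply_mem c)
  have h3 : ‖c - w‖ ^ 2 = ‖c‖ ^ 2 - 2 * inner ℝ c w + ‖w‖ ^ 2 := norm_sub_sq_real c w
  have h4 := norm_sub_sq_real (V.starProjection c) w
  rw [inner_sub_left, sub_eq_zero] at h1 h2
  rw [real_inner_self_eq_norm_sq] at h2
  nlinarith [sq_nonneg ‖V.starProjection c - w‖]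

theorem projMatrix_quadForm {n : ℕ} (V : Submodule ℝ (EuclideanSpace ℝ (Fin n)))
    (c : EuclideanSpace ℝ (Fin n)) :
    ∑ i, ∑ j, projMatrix V i j * (c i * c j) = inner ℝ c (V.starProjection c) := by
  have hc : c = ∑ j, c j • EuclideanSpace.single j (1 : ℝ) := by
    have := (EuclideanSpace.basisFun (Fin n) ℝ).sum_repr c
    simpa using this.symm
  have h2 : ∀ i, V.starProjection c i = ∑ j, c j * projMatrix V i j := fun i => by
    conv_lhs => rw [hc, map_sum]
    simp [projMatrix]
  rw [PiLp.inner_apply]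
  refine Finset.sum_congr rfl fun i _ => ?_
  rw [h2]
  simp only [RCLike.inner_apply, conj_trivial, Finset.sum_mul]
  exact Finset.sum_congr rfl fun j _ => by ring

theorem sum_projMatrix_mul_gram_ge {n d : ℕ} (V : Submodule ℝ (EuclideanSpace ℝ (Fin n)))
    (v w : Fin n → EuclideanSpace ℝ (Fin d))
    (hw : ∀ a, WithLp.toLp 2 (fun i => w i a) ∈ V) :
    ∑ i, ‖v i‖ ^ 2 - ∑ i, ‖v i - w i‖ ^ 2 ≤
      ∑ i, ∑ j, projMatrix V i j * Matrix.gram ℝ v i j := by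
  have h1 : ∀ u : Fin n → EuclideanSpace ℝ (Fin d),
      ∑ i, ‖u i‖ ^ 2 = ∑ a, ‖(WithLp.toLp 2 (fun i => u i a) : EuclideanSpace ℝ (Fin n))‖ ^ 2 := by
    intro u
    simp only [EuclideanSpace.norm_sq_eq, Real.norm_eq_abs, sq_abs]
    rw [Finset.sum_comm]
  have h2 : ∑ i, ∑ j, projMatrix V i j * Matrix.gram ℝ v i j =
      ∑ a, ∑ i, ∑ j, projMatrix V i j * (v i a * v j a) := by
    symm
    rw [Finset.sum_comm]
    refine Finset.sum_congr rfl fun i _ => ?_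
    rw [Finset.sum_comm]
    refine Finset.sum_congr rfl fun j _ => ?_
    rw [← Finset.mul_sum, Matrix.gram_apply, PiLp.inner_apply]
    congr 1
    refine Finset.sum_congr rfl fun a _ => ?_
    simp [mul_comm]
  have h3 := h1 fun i => v i - w i
  rw [h2, h1, h3, ← Finset.sum_sub_distrib]
  refine Finset.sum_le_sum fun a _ => ?_
  have h4 := projMatrix_quadForm V (WithLp.toLp 2 fun i => v i a)
  have h5 := real_inner_starProjection_ge V (WithLp.toLp 2 fun i => v i a) (hw a)
  rw [← h4] at h5
  exact h5

theorem projMatrix_diag_nonneg {n : ℕ} (V : Submodule ℝ (EuclideanSpace ℝ (Fin n))) (i : Fin n) :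
    0 ≤ projMatrix V i i := by
  have h := projMatrix_quadForm V (EuclideanSpace.single i 1)
  have h2 := real_inner_starProjection_ge V (EuclideanSpace.single i (1 : ℝ)) V.zero_mem
  simp only [sub_zero, sub_self] at h2
  rw [← h] at h2
  simpa [Pi.single_apply] using h2

/-! ### Moments of Gaussian vectors and of their directions. -/

section

open MeasureTheory ProbabilityTheory

theorem stdGaussian_map_inner_eq {d : ℕ} {e : EuclideanSpace ℝ (Fin d)} (he : ‖e‖ = 1) :
    (stdGaussian (EuclideanSpace ℝ (Fin d))).map (fun g => inner ℝ g e) = gaussianReal 0 1 := by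
  have h := IsGaussian.map_eq_gaussianReal (μ := stdGaussian (EuclideanSpace ℝ (Fin d)))
    (innerSL ℝ e)
  rw [integral_strongDual_stdGaussian, variance_dual_stdGaussian, innerSL_apply_norm, he] at h
  have h2 : (fun g : EuclideanSpace ℝ (Fin d) => inner ℝ g e) = innerSL ℝ e := by
    ext g; rw [innerSL_apply_apply, real_inner_comm]
  rw [h2, h]
  simp

theorem integral_stdGaussian_inner_pow {d : ℕ} {e : EuclideanSpace ℝ (Fin d)} (he : ‖e‖ = 1)
    (k : ℕ) :
    ∫ g, inner ℝ g e ^ k ∂(stdGaussian (EuclideanSpace ℝ (Fin d))) =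
      ∫ x, x ^ k ∂(gaussianReal 0 1) := by
  rw [← stdGaussian_map_inner_eq he, integral_map (by fun_prop) (by fun_prop)]

theorem integrable_stdGaussian_norm_pow (d k : ℕ) :
    Integrable (fun g => ‖g‖ ^ k) (stdGaussian (EuclideanSpace ℝ (Fin d))) := by
  have := (IsGaussian.memLp_id (stdGaussian (EuclideanSpace ℝ (Fin d))) k (by simp))
  exact this.integrable_norm_pow'

theorem integral_gaussianReal_sq : ∫ x, x ^ 2 ∂(gaussianReal 0 1) = 1 := by
  have h := variance_fun_id_gaussianReal (μ := 0) (v := 1)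
  rw [variance_of_integral_eq_zero (by fun_prop) (by simp)] at h
  simpa using h

theorem integral_gaussianReal_pow_four : ∫ x, x ^ 4 ∂(gaussianReal 0 1) = 3 := by
  have h := iteratedDeriv_mgf_zero (X := id) (μ := gaussianReal 0 1) (by simp) 4
  simp only [Pi.pow_apply, id_eq] at h
  rw [← h, mgf_id_gaussianReal]
  have d0 : ∀ t : ℝ, HasDerivAt (fun t : ℝ => Real.exp (0 * t + ((1 : NNReal) : ℝ) * t ^ 2 / 2))
      (t * Real.exp (t ^ 2 / 2)) t := fun t => by
    have : HasDerivAt (fun t : ℝ => 0 * t + ((1 : NNReal) : ℝ) * t ^ 2 / 2) t t := by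
      have := (hasDerivAt_pow 2 t).div_const 2
      simp only [zero_mul, zero_add, NNReal.coe_one, one_mul]
      exact this.congr_deriv (by simp)
    exact this.exp.congr_deriv (by simp [mul_comm])
  have d1 : ∀ (p : ℝ → ℝ) (p' t : ℝ), HasDerivAt p p' t →
      HasDerivAt (fun t => p t * Real.exp (t ^ 2 / 2))
        ((p' + p t * t) * Real.exp (t ^ 2 / 2)) t := by
    intro p p' t hp
    have h2 : HasDerivAt (fun t : ℝ => t ^ 2 / 2) t t := by
      have := (hasDerivAt_pow 2 t).div_const 2
      exact this.congr_deriv (by simp)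
    exact (hp.fun_mul h2.exp).congr_deriv (by ring)
  have e1 : iteratedDeriv 1 (fun t : ℝ => Real.exp (0 * t + ((1 : NNReal) : ℝ) * t ^ 2 / 2)) =
      fun t => t * Real.exp (t ^ 2 / 2) := by
    rw [iteratedDeriv_one]; ext t; exact (d0 t).deriv
  have e2 : iteratedDeriv 2 (fun t : ℝ => Real.exp (0 * t + ((1 : NNReal) : ℝ) * t ^ 2 / 2)) =
      fun t => (1 + t ^ 2) * Real.exp (t ^ 2 / 2) := by
    rw [iteratedDeriv_succ, e1]; ext t
    rw [(d1 (fun t => t) 1 t (hasDerivAt_id t)).deriv]; ring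
  have e3 : iteratedDeriv 3 (fun t : ℝ => Real.exp (0 * t + ((1 : NNReal) : ℝ) * t ^ 2 / 2)) =
      fun t => (3 * t + t ^ 3) * Real.exp (t ^ 2 / 2) := by
    rw [iteratedDeriv_succ, e2]; ext t
    rw [(d1 (fun t => 1 + t ^ 2) (2 * t) t
      (by simpa using (hasDerivAt_pow 2 t).const_add 1)).deriv]; ring
  rw [iteratedDeriv_succ, e3, (d1 (fun t => 3 * t + t ^ 3) (3 + 3 * (0 : ℝ) ^ 2) 0
    (by
      simpa using ((hasDerivAt_id (0 : ℝ)).const_mul 3).fun_add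
        (hasDerivAt_pow 3 (0 : ℝ)))).deriv]
  simp

theorem integral_stdGaussian_comp {d : ℕ}
    (U : EuclideanSpace ℝ (Fin d) ≃ₗᵢ[ℝ] EuclideanSpace ℝ (Fin d))
    (f : EuclideanSpace ℝ (Fin d) → ℝ) :
    ∫ g, f (U g) ∂(stdGaussian (EuclideanSpace ℝ (Fin d))) =
      ∫ g, f g ∂(stdGaussian (EuclideanSpace ℝ (Fin d))) := by
  have h := stdGaussian_map (E := EuclideanSpace ℝ (Fin d)) U
  conv_rhs => rw [← h]
  exact (integral_map_equiv U.toHomeomorph.toMeasurableEquiv f).symm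

/-- The moments of an orthogonally equivariant function of a standard Gaussian vector. -/
theorem integral_inner_pow_of_equivariant {d : ℕ}
    {F : EuclideanSpace ℝ (Fin d) → EuclideanSpace ℝ (Fin d)}
    (hF : ∀ (U : EuclideanSpace ℝ (Fin d) ≃ₗᵢ[ℝ] EuclideanSpace ℝ (Fin d)) g, F (U g) = U (F g))
    {e : EuclideanSpace ℝ (Fin d)} (he : ‖e‖ = 1) (k : ℕ) (a : EuclideanSpace ℝ (Fin d)) :
    ∫ g, inner ℝ (F g) a ^ k ∂(stdGaussian (EuclideanSpace ℝ (Fin d))) =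
      ‖a‖ ^ k * ∫ g, inner ℝ (F g) e ^ k ∂(stdGaussian (EuclideanSpace ℝ (Fin d))) := by
  have hn : ‖a‖ = ‖‖a‖ • e‖ := by rw [norm_smul, norm_norm, he, mul_one]
  -- A reflection carrying `a` to the multiple of `e` of the same length.
  let U := (ℝ ∙ (a - ‖a‖ • e))ᗮ.reflection
  have hU : U a = ‖a‖ • e := Submodule.reflection_sub hn
  have h1 : ∀ g, inner ℝ (F g) a = inner ℝ (F (U g)) (‖a‖ • e) := fun g => by
    rw [hF, ← hU, U.inner_map_map]
  simp_rw [h1]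
  rw [integral_stdGaussian_comp U (fun g => inner ℝ (F g) (‖a‖ • e) ^ k)]
  simp_rw [real_inner_smul_right, mul_pow]
  rw [integral_const_mul]

/-- Polarisation: the mixed moment is a combination of pure fourth moments along `a + b`, `a - b`,
`a` and `b`. -/
theorem integral_inner_sq_mul_inner_sq {d : ℕ} {μ : Measure (EuclideanSpace ℝ (Fin d))}
    {F : EuclideanSpace ℝ (Fin d) → EuclideanSpace ℝ (Fin d)} {c : ℝ}
    (hi : ∀ a, Integrable (fun g => inner ℝ (F g) a ^ 4) μ)
    (hc : ∀ a, ∫ g, inner ℝ (F g) a ^ 4 ∂μ = c * ‖a‖ ^ 4) (a b : EuclideanSpace ℝ (Fin d)) :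
    ∫ g, inner ℝ (F g) a ^ 2 * inner ℝ (F g) b ^ 2 ∂μ =
      c / 3 * (‖a‖ ^ 2 * ‖b‖ ^ 2 + 2 * inner ℝ a b ^ 2) := by
  have e1 : ∀ g, inner ℝ (F g) a ^ 2 * inner ℝ (F g) b ^ 2 =
      1 / 12 * (inner ℝ (F g) (a + b) ^ 4 + inner ℝ (F g) (a - b) ^ 4
        - 2 * inner ℝ (F g) a ^ 4 - 2 * inner ℝ (F g) b ^ 4) := fun g => by
    rw [inner_add_right, inner_sub_right]; ring
  simp_rw [e1]
  have i1 : Integrable (fun g => inner ℝ (F g) (a + b) ^ 4 + inner ℝ (F g) (a - b) ^ 4) μ :=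
    (hi _).add (hi _)
  have i2 : Integrable (fun g => inner ℝ (F g) (a + b) ^ 4 + inner ℝ (F g) (a - b) ^ 4
      - 2 * inner ℝ (F g) a ^ 4) μ := i1.sub ((hi _).const_mul _)
  rw [integral_const_mul, integral_sub i2 ((hi _).const_mul _),
    integral_sub i1 ((hi _).const_mul _), integral_add (hi _) (hi _), integral_const_mul,
    integral_const_mul, hc, hc, hc, hc]
  have n1 := norm_add_sq_real a b
  have n2 := norm_sub_sq_real a b
  have f1 : ‖a + b‖ ^ 4 = (‖a + b‖ ^ 2) ^ 2 := by ring
  have f2 : ‖a - b‖ ^ 4 = (‖a - b‖ ^ 2) ^ 2 := by ring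
  rw [f1, f2, n1, n2]
  ring

/-- The direction of a vector. -/
noncomputable def unitVec {d : ℕ} (g : EuclideanSpace ℝ (Fin d)) : EuclideanSpace ℝ (Fin d) :=
  ‖g‖⁻¹ • g

theorem measurable_unitVec {d : ℕ} : Measurable (unitVec (d := d)) := by
  unfold unitVec; fun_prop

theorem unitVec_map {d : ℕ} (U : EuclideanSpace ℝ (Fin d) ≃ₗᵢ[ℝ] EuclideanSpace ℝ (Fin d))
    (g : EuclideanSpace ℝ (Fin d)) : unitVec (U g) = U (unitVec g) := by
  simp [unitVec]

theorem norm_unitVec {d : ℕ} {g : EuclideanSpace ℝ (Fin d)} (hg : g ≠ 0) : ‖unitVec g‖ = 1 := by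
  rw [unitVec, norm_smul, norm_inv, norm_norm, inv_mul_cancel₀ (norm_ne_zero_iff.2 hg)]

theorem norm_unitVec_le {d : ℕ} (g : EuclideanSpace ℝ (Fin d)) : ‖unitVec g‖ ≤ 1 := by
  by_cases hg : g = 0
  · simp [unitVec, hg]
  · exact (norm_unitVec hg).le

theorem abs_inner_unitVec_le {d : ℕ} (g a : EuclideanSpace ℝ (Fin d)) :
    |inner ℝ (unitVec g) a| ≤ ‖a‖ :=
  (abs_real_inner_le_norm _ _).trans
    (mul_le_of_le_one_left (norm_nonneg _) (norm_unitVec_le g))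

theorem exists_norm_eq_one {d : ℕ} (hd : 0 < d) : ∃ e : EuclideanSpace ℝ (Fin d), ‖e‖ = 1 :=
  ⟨EuclideanSpace.single ⟨0, hd⟩ 1, by simp⟩

theorem ae_stdGaussian_ne_zero {d : ℕ} (hd : 0 < d) :
    ∀ᵐ g ∂(stdGaussian (EuclideanSpace ℝ (Fin d))), g ≠ 0 := by
  obtain ⟨e, he⟩ := exists_norm_eq_one hd
  have h1 : ∀ᵐ x ∂(gaussianReal 0 1), x ≠ 0 := by
    have := nullSingletonClass_gaussianReal (μ := 0) (v := 1) (by simp)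
    rw [ae_iff]
    simp
  rw [← stdGaussian_map_inner_eq he] at h1
  have h2 := ae_of_ae_map (by fun_prop) h1
  filter_upwards [h2] with g hg h0
  simp [h0] at hg

theorem integrable_inner_unitVec_pow {d : ℕ} (a : EuclideanSpace ℝ (Fin d)) (k : ℕ) :
    Integrable (fun g => inner ℝ (unitVec g) a ^ k)
      (stdGaussian (EuclideanSpace ℝ (Fin d))) := by
  refine Integrable.of_bound (C := ‖a‖ ^ k) ?_ (.of_forall fun g => ?_)
  · have := measurable_unitVec (d := d)
    exact Measurable.aestronglyMeasurable (by fun_prop)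
  · rw [norm_pow, Real.norm_eq_abs]
    exact pow_le_pow_left₀ (abs_nonneg _) (abs_inner_unitVec_le g a) k

theorem sum_inner_basisFun_sq {d : ℕ} (x : EuclideanSpace ℝ (Fin d)) :
    ∑ a, inner ℝ x (EuclideanSpace.basisFun (Fin d) ℝ a) ^ 2 = ‖x‖ ^ 2 := by
  have := (EuclideanSpace.basisFun (Fin d) ℝ).sum_sq_norm_inner_left x
  simpa [Real.norm_eq_abs, sq_abs] using this

/-- The fourth moment of the norm, from the fourth moments of the coordinates. -/
theorem integral_norm_pow_four {d : ℕ} {μ : Measure (EuclideanSpace ℝ (Fin d))}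
    {F : EuclideanSpace ℝ (Fin d) → EuclideanSpace ℝ (Fin d)} {c : ℝ}
    (hm : AEStronglyMeasurable F μ)
    (hi : ∀ a, Integrable (fun g => inner ℝ (F g) a ^ 4) μ)
    (hc : ∀ a, ∫ g, inner ℝ (F g) a ^ 4 ∂μ = c * ‖a‖ ^ 4) :
    ∫ g, ‖F g‖ ^ 4 ∂μ = c / 3 * (d * (d + 2)) := by
  have hij : ∀ a b : EuclideanSpace ℝ (Fin d),
      Integrable (fun g => inner ℝ (F g) a ^ 2 * inner ℝ (F g) b ^ 2) μ := fun a b => by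
    refine ((hi a).add (hi b)).mono' ?_ (.of_forall fun g => ?_)
    · fun_prop
    · rw [Real.norm_of_nonneg (by positivity)]
      simp only [Pi.add_apply]
      nlinarith [sq_nonneg (inner ℝ (F g) a ^ 2 - inner ℝ (F g) b ^ 2),
        sq_nonneg (inner ℝ (F g) a ^ 2), sq_nonneg (inner ℝ (F g) b ^ 2)]
  have e1 : ∀ g, ‖F g‖ ^ 4 = ∑ i, ∑ j, inner ℝ (F g) (EuclideanSpace.basisFun (Fin d) ℝ i) ^ 2
      * inner ℝ (F g) (EuclideanSpace.basisFun (Fin d) ℝ j) ^ 2 := fun g => by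
    rw [← Finset.sum_mul_sum, sum_inner_basisFun_sq]; ring
  simp_rw [e1]
  rw [integral_finsetSum _ fun i _ => integrable_finsetSum _ fun j _ => hij _ _]
  simp_rw [integral_finsetSum _ fun j _ => hij _ _, integral_inner_sq_mul_inner_sq hi hc]
  simp only [OrthonormalBasis.norm_eq_one, orthonormal_iff_ite.1
    (EuclideanSpace.basisFun (Fin d) ℝ).orthonormal]
  simp only [one_pow, mul_one, ite_pow, zero_pow two_ne_zero, mul_add, mul_ite, mul_zero,
    Finset.sum_add_distrib, Finset.sum_ite_eq, Finset.mem_univ, if_true, Finset.sum_const,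
    Finset.card_univ, Fintype.card_fin, nsmul_eq_mul]
  ring

theorem integral_unitVec_sq {d : ℕ} (hd : 0 < d) {a : EuclideanSpace ℝ (Fin d)} (ha : ‖a‖ = 1) :
    ∫ g, inner ℝ (unitVec g) a ^ 2 ∂(stdGaussian (EuclideanSpace ℝ (Fin d))) = 1 / d := by
  have h : ∫ g, ∑ i, inner ℝ (unitVec g) (EuclideanSpace.basisFun (Fin d) ℝ i) ^ 2
      ∂(stdGaussian (EuclideanSpace ℝ (Fin d))) = 1 := by
    have : ∀ᵐ g ∂(stdGaussian (EuclideanSpace ℝ (Fin d))),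
        ∑ i, inner ℝ (unitVec g) (EuclideanSpace.basisFun (Fin d) ℝ i) ^ 2 = 1 := by
      filter_upwards [ae_stdGaussian_ne_zero hd] with g hg
      rw [sum_inner_basisFun_sq, norm_unitVec hg, one_pow]
    rw [integral_congr_ae this]; simp
  rw [integral_finsetSum _ fun i _ => integrable_inner_unitVec_pow _ 2] at h
  rw [Finset.sum_congr rfl fun i _ => integral_inner_pow_of_equivariant unitVec_map ha 2
    (EuclideanSpace.basisFun (Fin d) ℝ i)] at h
  simp only [OrthonormalBasis.norm_eq_one, one_pow, one_mul, Finset.sum_const,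
    Finset.card_univ, Fintype.card_fin, nsmul_eq_mul] at h
  rw [eq_div_iff (by positivity), mul_comm, h]

/-- Rotation invariance gives the form up to one constant, which is fixed by `‖unitVec g‖ = 1`
almost surely. -/
theorem integral_unitVec_sq_mul_sq {d : ℕ} (hd : 0 < d) (a b : EuclideanSpace ℝ (Fin d)) :
    ∫ g, inner ℝ (unitVec g) a ^ 2 * inner ℝ (unitVec g) b ^ 2
      ∂(stdGaussian (EuclideanSpace ℝ (Fin d))) =
      (‖a‖ ^ 2 * ‖b‖ ^ 2 + 2 * inner ℝ a b ^ 2) / (d * (d + 2)) := by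
  obtain ⟨e, he⟩ := exists_norm_eq_one hd
  set c := ∫ g, inner ℝ (unitVec g) e ^ 4 ∂(stdGaussian (EuclideanSpace ℝ (Fin d)))
  have hc : ∀ a, ∫ g, inner ℝ (unitVec g) a ^ 4 ∂(stdGaussian (EuclideanSpace ℝ (Fin d))) =
      c * ‖a‖ ^ 4 := fun a => by
    rw [integral_inner_pow_of_equivariant unitVec_map he 4, mul_comm]
  have h4 := integral_norm_pow_four measurable_unitVec.aestronglyMeasurable
    (fun a => integrable_inner_unitVec_pow a 4) hc
  have h1 : ∫ g, ‖unitVec g‖ ^ 4 ∂(stdGaussian (EuclideanSpace ℝ (Fin d))) = 1 := by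
    have : ∀ᵐ g ∂(stdGaussian (EuclideanSpace ℝ (Fin d))), ‖unitVec g‖ ^ 4 = 1 := by
      filter_upwards [ae_stdGaussian_ne_zero hd] with g hg
      rw [norm_unitVec hg, one_pow]
    rw [integral_congr_ae this]; simp
  rw [integral_inner_sq_mul_inner_sq (fun a => integrable_inner_unitVec_pow a 4) hc,
    eq_div_iff (by positivity)]
  linear_combination (‖a‖ ^ 2 * ‖b‖ ^ 2 + 2 * inner ℝ a b ^ 2) * (h1 - h4)

/-- The function `u ↦ ⟨u, a⟩² - 1 / d` is a zonal harmonic of degree two, so convolution reproduces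
it up to a scalar. Integrating out an intermediate vertex of a walk thus merges its two edges into
one at the cost of a factor `2 / (d * (d + 2))`. -/
theorem integral_centered_mul_centered {d : ℕ} (hd : 0 < d) {a b : EuclideanSpace ℝ (Fin d)}
    (ha : ‖a‖ = 1) (hb : ‖b‖ = 1) :
    ∫ g, (inner ℝ (unitVec g) a ^ 2 - 1 / d) * (inner ℝ (unitVec g) b ^ 2 - 1 / d)
      ∂(stdGaussian (EuclideanSpace ℝ (Fin d))) =
      2 / (d * (d + 2)) * (inner ℝ a b ^ 2 - 1 / d) := by
  have ia := integrable_inner_unitVec_pow a 2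
  have ib := integrable_inner_unitVec_pow b 2
  have iab : Integrable (fun g => inner ℝ (unitVec g) a ^ 2 * inner ℝ (unitVec g) b ^ 2)
      (stdGaussian (EuclideanSpace ℝ (Fin d))) := by
    refine ia.mul_bdd (c := 1) ib.aestronglyMeasurable (.of_forall fun g => ?_)
    rw [Real.norm_of_nonneg (sq_nonneg _), ← sq_abs]
    exact pow_le_one₀ (abs_nonneg _) ((abs_inner_unitVec_le g b).trans hb.le)
  have e1 : ∀ g, (inner ℝ (unitVec g) a ^ 2 - 1 / (d : ℝ)) *
      (inner ℝ (unitVec g) b ^ 2 - 1 / (d : ℝ)) =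
      inner ℝ (unitVec g) a ^ 2 * inner ℝ (unitVec g) b ^ 2
      - 1 / (d : ℝ) * inner ℝ (unitVec g) a ^ 2
      - 1 / (d : ℝ) * inner ℝ (unitVec g) b ^ 2 + (1 / (d : ℝ)) ^ 2 := fun g => by ring
  simp_rw [e1]
  have i1 : Integrable (fun g => inner ℝ (unitVec g) a ^ 2 * inner ℝ (unitVec g) b ^ 2
      - 1 / (d : ℝ) * inner ℝ (unitVec g) a ^ 2) (stdGaussian (EuclideanSpace ℝ (Fin d))) :=
    iab.sub (ia.const_mul _)
  have i2 : Integrable (fun g => inner ℝ (unitVec g) a ^ 2 * inner ℝ (unitVec g) b ^ 2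
      - 1 / (d : ℝ) * inner ℝ (unitVec g) a ^ 2 - 1 / (d : ℝ) * inner ℝ (unitVec g) b ^ 2)
      (stdGaussian (EuclideanSpace ℝ (Fin d))) := i1.sub (ib.const_mul _)
  rw [integral_add i2 (integrable_const _), integral_sub i1 (ib.const_mul _),
    integral_sub iab (ia.const_mul _), integral_const_mul, integral_const_mul,
    integral_unitVec_sq hd ha, integral_unitVec_sq hd hb, integral_unitVec_sq_mul_sq hd, ha, hb]
  simp only [integral_const, probReal_univ, one_smul]
  have : (d : ℝ) ≠ 0 := by positivity
  field_simp
  ring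

theorem integral_stdGaussian_norm_sq (d : ℕ) :
    ∫ g, ‖g‖ ^ 2 ∂(stdGaussian (EuclideanSpace ℝ (Fin d))) = d := by
  have hi : ∀ a : EuclideanSpace ℝ (Fin d), Integrable (fun g => inner ℝ g a ^ 2)
      (stdGaussian (EuclideanSpace ℝ (Fin d))) := fun a => by
    refine ((integrable_stdGaussian_norm_pow d 2).mul_const (‖a‖ ^ 2)).mono' (by fun_prop)
      (.of_forall fun g => ?_)
    rw [norm_pow, Real.norm_eq_abs, ← mul_pow]
    exact pow_le_pow_left₀ (abs_nonneg _) (abs_real_inner_le_norm _ _) _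
  simp_rw [← sum_inner_basisFun_sq]
  rw [integral_finsetSum _ fun i _ => hi _, Finset.sum_congr rfl fun i _ =>
    (integral_stdGaussian_inner_pow ((EuclideanSpace.basisFun (Fin d) ℝ).norm_eq_one i) 2).trans
      integral_gaussianReal_sq]
  simp

theorem integral_norm_sq_div_sub_one_sq {d : ℕ} (hd : 0 < d) :
    ∫ g, (1 - ‖g‖ ^ 2 / (d : ℝ)) ^ 2 ∂(stdGaussian (EuclideanSpace ℝ (Fin d))) = 2 / (d : ℝ) := by
  obtain ⟨e, he⟩ := exists_norm_eq_one hd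
  have hi : ∀ a : EuclideanSpace ℝ (Fin d), Integrable (fun g => inner ℝ (id g) a ^ 4)
      (stdGaussian (EuclideanSpace ℝ (Fin d))) := fun a => by
    refine ((integrable_stdGaussian_norm_pow d 4).mul_const (‖a‖ ^ 4)).mono' (by fun_prop)
      (.of_forall fun g => ?_)
    rw [norm_pow, Real.norm_eq_abs, ← mul_pow]
    exact pow_le_pow_left₀ (abs_nonneg _) (abs_real_inner_le_norm _ _) _
  have hc : ∀ a, ∫ g, inner ℝ (id g) a ^ 4 ∂(stdGaussian (EuclideanSpace ℝ (Fin d))) =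
      3 * ‖a‖ ^ 4 := fun a => by
    rw [integral_inner_pow_of_equivariant (F := id) (fun _ _ => rfl) he 4, mul_comm]
    simp only [id_eq]
    rw [integral_stdGaussian_inner_pow he, integral_gaussianReal_pow_four]
  have h4 := integral_norm_pow_four aestronglyMeasurable_id hi hc
  simp only [id_eq] at h4
  have e1 : ∀ g : EuclideanSpace ℝ (Fin d), (1 - ‖g‖ ^ 2 / (d : ℝ)) ^ 2 =
      1 - 2 / (d : ℝ) * ‖g‖ ^ 2 + (1 / (d : ℝ) ^ 2) * ‖g‖ ^ 4 := fun g => by ring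
  simp_rw [e1]
  have i2 := (integrable_stdGaussian_norm_pow d 2).const_mul (2 / (d : ℝ))
  have i4 := (integrable_stdGaussian_norm_pow d 4).const_mul (1 / (d : ℝ) ^ 2)
  have i1 : Integrable (fun g => 1 - 2 / (d : ℝ) * ‖g‖ ^ 2)
      (stdGaussian (EuclideanSpace ℝ (Fin d))) := (integrable_const _).sub i2
  rw [integral_add i1 i4, integral_sub (integrable_const _) i2, integral_const_mul,
    integral_const_mul, h4, integral_stdGaussian_norm_sq]
  simp only [integral_const, probReal_univ, one_smul]
  have : (d : ℝ) ≠ 0 := by positivity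
  field_simp
  ring

/-- Even moments of a coordinate of a uniformly random unit vector. -/
theorem integral_inner_unitVec_even_pow_le {d : ℕ} (hd : 0 < d) {a : EuclideanSpace ℝ (Fin d)}
    (ha : ‖a‖ = 1) (p : ℕ) :
    ∫ g, inner ℝ (unitVec g) a ^ (2 * p) ∂(stdGaussian (EuclideanSpace ℝ (Fin d))) ≤
      (∫ x, x ^ (2 * p) ∂(gaussianReal 0 1)) / (d : ℝ) ^ p := by
  set γ := stdGaussian (EuclideanSpace ℝ (Fin d)) with hγ
  -- Pair the direction with an independent Gaussian `h` and integrate in both orders. Integrating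
  -- over `h` first gives a Gaussian moment; integrating over the direction first gives the wanted
  -- moment times the mean of `‖h‖ ^ (2 * p)`.
  have hintg : Integrable (Function.uncurry fun (g h : EuclideanSpace ℝ (Fin d)) =>
      inner ℝ (unitVec g) h ^ (2 * p)) (γ.prod γ) := by
    have hb : Integrable (fun z : EuclideanSpace ℝ (Fin d) × EuclideanSpace ℝ (Fin d) =>
        ‖z.2‖ ^ (2 * p)) (γ.prod γ) := (integrable_stdGaussian_norm_pow d (2 * p)).comp_snd γ
    refine hb.mono' ?_ (.of_forall fun z => ?_)
    · have := measurable_unitVec (d := d)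
      exact Measurable.aestronglyMeasurable (by unfold Function.uncurry; fun_prop)
    · simp only [Function.uncurry]
      rw [norm_pow, Real.norm_eq_abs]
      exact pow_le_pow_left₀ (abs_nonneg _) (abs_inner_unitVec_le _ _) _
  have hswap := integral_integral_swap hintg
  have hL : ∫ g, ∫ h, inner ℝ (unitVec g) h ^ (2 * p) ∂γ ∂γ =
      ∫ x, x ^ (2 * p) ∂(gaussianReal 0 1) := by
    have : ∀ᵐ g ∂γ, ∫ h, inner ℝ (unitVec g) h ^ (2 * p) ∂γ =
        ∫ x, x ^ (2 * p) ∂(gaussianReal 0 1) := by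
      filter_upwards [ae_stdGaussian_ne_zero hd] with g hg
      simp_rw [real_inner_comm _ (unitVec g)]
      exact integral_stdGaussian_inner_pow (norm_unitVec hg) _
    rw [integral_congr_ae this]; simp
  have hR : ∫ h, ∫ g, inner ℝ (unitVec g) h ^ (2 * p) ∂γ ∂γ =
      (∫ h, ‖h‖ ^ (2 * p) ∂γ) * ∫ g, inner ℝ (unitVec g) a ^ (2 * p) ∂γ := by
    rw [← integral_mul_const]
    exact integral_congr_ae (.of_forall fun h =>
      integral_inner_pow_of_equivariant unitVec_map ha (2 * p) h)
  -- Jensen's inequality for `t ↦ t ^ p`, with the mean of `‖h‖ ^ 2` equal to `d`.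
  have hJ : (d : ℝ) ^ p ≤ ∫ h, ‖h‖ ^ (2 * p) ∂γ := by
    have := (convexOn_pow p).map_integral_le (μ := γ) (f := fun h => ‖h‖ ^ 2)
      (continuous_pow p).continuousOn isClosed_Ici (.of_forall fun h => by simp)
      (integrable_stdGaussian_norm_pow d 2)
      (by simpa [Function.comp_def, ← pow_mul] using integrable_stdGaussian_norm_pow d (2 * p))
    rw [integral_stdGaussian_norm_sq] at this
    simpa [← pow_mul] using this
  rw [hL, hR] at hswap
  rw [le_div_iff₀ (by positivity), hswap, mul_comm]
  refine mul_le_mul_of_nonneg_right hJ (integral_nonneg fun g => ?_)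
  simp only [Pi.zero_apply]
  rw [pow_mul]; positivity

/-! ### Correlations between independent Gaussian rows. -/

theorem measurePreserving_update {ι α : Type*} [Fintype ι] [DecidableEq ι] [MeasurableSpace α]
    (γ : Measure α) [IsProbabilityMeasure γ] (j : ι) :
    MeasurePreserving (fun z : (ι → α) × α => Function.update z.1 j z.2)
      ((Measure.pi fun _ : ι => γ).prod γ) (Measure.pi fun _ : ι => γ) := by
  have hm : Measurable (fun z : (ι → α) × α => Function.update z.1 j z.2) := by
    refine measurable_pi_iff.2 fun i => ?_
    by_cases h : i = j
    · subst h; simpa using measurable_snd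
    · simp only [Function.update_of_ne h]; fun_prop
  refine ⟨hm, (Measure.pi_eq fun s hs => ?_).symm⟩
  rw [Measure.map_apply hm (MeasurableSet.univ_pi hs)]
  have : (fun z : (ι → α) × α => Function.update z.1 j z.2) ⁻¹' (Set.univ.pi s) =
      (Set.univ.pi (Function.update s j Set.univ)) ×ˢ s j := by
    ext z
    simp only [Set.mem_preimage, Set.mem_univ_pi, Set.mem_prod]
    constructor
    · intro h
      refine ⟨fun i => ?_, by simpa using h j⟩
      by_cases hi : i = j
      · subst hi; simp
      · simpa [Function.update_of_ne hi] using h i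
    · rintro ⟨h1, h2⟩ i
      by_cases hi : i = j
      · subst hi; simpa using h2
      · simpa [Function.update_of_ne hi] using h1 i
  rw [this, Measure.prod_prod, Measure.pi_pi, ← Finset.mul_prod_erase _ _ (Finset.mem_univ j),
    ← Finset.mul_prod_erase _ (fun i => γ (s i)) (Finset.mem_univ j)]
  simp only [Function.update_self, measure_univ, one_mul]
  rw [mul_comm]
  congr 1
  refine Finset.prod_congr rfl fun i hi => ?_
  rw [Function.update_of_ne (Finset.ne_of_mem_erase hi)]

/-- Resampling one coordinate preserves the product law; this allows integration over a single row
with the others fixed. -/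
theorem integral_pi_update {ι α : Type*} [Fintype ι] [DecidableEq ι] [MeasurableSpace α]
    (γ : Measure α) [IsProbabilityMeasure γ] (j : ι) {F : (ι → α) → ℝ} (hF : Measurable F)
    {C : ℝ} (hC : ∀ x, |F x| ≤ C) :
    ∫ x, F x ∂(Measure.pi fun _ : ι => γ) =
      ∫ x, ∫ y, F (Function.update x j y) ∂γ ∂(Measure.pi fun _ : ι => γ) := by
  have h := measurePreserving_update γ j
  conv_lhs => rw [← h.map_eq]
  rw [integral_map h.measurable.aemeasurable hF.aestronglyMeasurable, integral_prod]
  exact Integrable.of_bound (hF.comp h.measurable).aestronglyMeasurable (C := C)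
    (.of_forall fun z => hC _)

/-- The centred squared correlation of the directions of two vectors. -/
noncomputable def centeredCorr {d : ℕ} (a b : EuclideanSpace ℝ (Fin d)) : ℝ :=
  inner ℝ (unitVec a) (unitVec b) ^ 2 - 1 / (d : ℝ)

theorem centeredCorr_comm {d : ℕ} (a b : EuclideanSpace ℝ (Fin d)) :
    centeredCorr a b = centeredCorr b a := by
  unfold centeredCorr; rw [real_inner_comm]

theorem measurable_centeredCorr {d : ℕ} {α : Type*} [MeasurableSpace α]
    {f g : α → EuclideanSpace ℝ (Fin d)} (hf : Measurable f) (hg : Measurable g) :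
    Measurable fun x => centeredCorr (f x) (g x) := by
  have := measurable_unitVec (d := d)
  unfold centeredCorr; fun_prop

theorem inner_unitVec_sq_le_one {d : ℕ} (a b : EuclideanSpace ℝ (Fin d)) :
    inner ℝ (unitVec a) (unitVec b) ^ 2 ≤ 1 := by
  rw [← sq_abs]
  exact pow_le_one₀ (abs_nonneg _) ((abs_inner_unitVec_le _ _).trans (norm_unitVec_le b))

theorem abs_centeredCorr_le {d : ℕ} (a b : EuclideanSpace ℝ (Fin d)) :
    |centeredCorr a b| ≤ 1 := by
  have h1 := inner_unitVec_sq_le_one a b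
  have h2 := sq_nonneg (inner ℝ (unitVec a) (unitVec b) : ℝ)
  have h3 : (1 : ℝ) / d ≤ 1 := by
    rcases Nat.eq_zero_or_pos d with h | h
    · simp [h]
    · rw [div_le_one (by positivity)]; exact_mod_cast h
  have h4 : (0 : ℝ) ≤ 1 / d := by positivity
  unfold centeredCorr
  rw [abs_le]
  constructor <;> linarith

theorem integral_centeredCorr_mul {d : ℕ} (hd : 0 < d) {a b : EuclideanSpace ℝ (Fin d)}
    (ha : a ≠ 0) (hb : b ≠ 0) :
    ∫ g, centeredCorr g a * centeredCorr g b ∂(stdGaussian (EuclideanSpace ℝ (Fin d))) =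
      2 / ((d : ℝ) * (d + 2)) * centeredCorr a b :=
  integral_centered_mul_centered hd (norm_unitVec ha) (norm_unitVec hb)

theorem integral_centeredCorr_sq_le {d : ℕ} (hd : 0 < d) {a : EuclideanSpace ℝ (Fin d)}
    (ha : a ≠ 0) :
    ∫ g, centeredCorr g a ^ 2 ∂(stdGaussian (EuclideanSpace ℝ (Fin d))) ≤
      2 / ((d : ℝ) * (d + 2)) := by
  simp_rw [sq]
  rw [integral_centeredCorr_mul hd ha ha]
  exact mul_le_of_le_one_right (by positivity) ((le_abs_self _).trans (abs_centeredCorr_le a a))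

/-- The law of a matrix with independent standard Gaussian rows in `ℝᵈ`. -/
noncomputable abbrev gaussianRows (n d : ℕ) : Measure (Fin n → EuclideanSpace ℝ (Fin d)) :=
  Measure.pi fun _ => stdGaussian (EuclideanSpace ℝ (Fin d))

theorem ae_gaussianRows_ne_zero {n d : ℕ} (hd : 0 < d) :
    ∀ᵐ x ∂(gaussianRows n d), ∀ i, x i ≠ 0 := by
  rw [ae_all_iff]
  intro i
  exact (measurePreserving_eval (fun _ => stdGaussian (EuclideanSpace ℝ (Fin d)))
    i).quasiMeasurePreserving.ae (ae_stdGaussian_ne_zero hd)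

theorem integral_centeredCorr_rows_sq_le {n d : ℕ} (hd : 0 < d) {i j : Fin n} (hij : i ≠ j) :
    ∫ x, centeredCorr (x i) (x j) ^ 2 ∂(gaussianRows n d) ≤ 2 / ((d : ℝ) * (d + 2)) := by
  rw [integral_pi_update _ i (C := 1)
    ((measurable_centeredCorr (measurable_pi_apply i) (measurable_pi_apply j)).pow_const 2)
    (fun x => by rw [abs_pow]; exact pow_le_one₀ (abs_nonneg _) (abs_centeredCorr_le _ _))]
  simp only [Function.update_self, Function.update_of_ne hij.symm]
  refine (integral_mono_of_nonneg (.of_forall fun x => integral_nonneg fun y => sq_nonneg _)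
    (integrable_const (2 / ((d : ℝ) * (d + 2)))) ?_).trans_eq (by simp)
  filter_upwards [ae_gaussianRows_ne_zero hd] with x hx
  exact integral_centeredCorr_sq_le hd (hx j)

theorem integral_centeredCorr_path_sq_le {n d : ℕ} (hd : 0 < d) {i j k : Fin n} (hij : i ≠ j)
    (hik : i ≠ k) (hjk : j ≠ k) :
    ∫ x, centeredCorr (x i) (x j) ^ 2 * centeredCorr (x j) (x k) ^ 2 ∂(gaussianRows n d) ≤
      (2 / ((d : ℝ) * (d + 2))) ^ 2 := by
  have hm : ∀ i j : Fin n, Measurable fun x : Fin n → EuclideanSpace ℝ (Fin d) =>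
      centeredCorr (x i) (x j) := fun i j =>
    measurable_centeredCorr (measurable_pi_apply i) (measurable_pi_apply j)
  have hb : ∀ a b : EuclideanSpace ℝ (Fin d), |centeredCorr a b ^ 2| ≤ 1 := fun a b => by
    rw [abs_pow]; exact pow_le_one₀ (abs_nonneg _) (abs_centeredCorr_le _ _)
  rw [integral_pi_update _ i (C := 1) (((hm i j).pow_const 2).fun_mul ((hm j k).pow_const 2))
    (fun x => by
      rw [abs_mul]; exact mul_le_one₀ (hb _ _) (abs_nonneg _) (hb _ _))]
  simp only [Function.update_self, Function.update_of_ne hij.symm, Function.update_of_ne hik.symm,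
    integral_mul_const]
  calc _ ≤ ∫ x, 2 / ((d : ℝ) * (d + 2)) * centeredCorr (x j) (x k) ^ 2 ∂(gaussianRows n d) := by
        refine integral_mono_of_nonneg (.of_forall fun x => mul_nonneg
          (integral_nonneg fun y => sq_nonneg _) (sq_nonneg _)) (Integrable.const_mul ?_ _) ?_
        · exact Integrable.of_bound ((hm j k).pow_const 2).aestronglyMeasurable (C := 1)
            (.of_forall fun x => hb _ _)
        · filter_upwards [ae_gaussianRows_ne_zero hd] with x hx
          exact mul_le_mul_of_nonneg_right (integral_centeredCorr_sq_le hd (hx j)) (sq_nonneg _)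
    _ ≤ _ := by
        rw [integral_const_mul, sq]
        exact mul_le_mul_of_nonneg_left (integral_centeredCorr_rows_sq_le hd hjk) (by positivity)

/-- Integrating out `j` and then `l` contracts the 4-cycle to a squared edge between `i` and `k`.
Each of the three integrations yields one factor `2 / (d * (d + 2))`. -/
theorem integral_centeredCorr_cycle_le {n d : ℕ} (hd : 0 < d) {i j l k : Fin n} (hij : i ≠ j)
    (hil : i ≠ l) (hik : i ≠ k) (hjl : j ≠ l) (hjk : j ≠ k) (hlk : l ≠ k) :
    ∫ x, centeredCorr (x i) (x j) * centeredCorr (x j) (x k) *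
      (centeredCorr (x i) (x l) * centeredCorr (x l) (x k)) ∂(gaussianRows n d) ≤
      (2 / ((d : ℝ) * (d + 2))) ^ 3 := by
  have hm : ∀ i j : Fin n, Measurable fun x : Fin n → EuclideanSpace ℝ (Fin d) =>
      centeredCorr (x i) (x j) := fun i j =>
    measurable_centeredCorr (measurable_pi_apply i) (measurable_pi_apply j)
  have hb : ∀ a b c e : EuclideanSpace ℝ (Fin d), |centeredCorr a b * centeredCorr c e| ≤ 1 :=
    fun a b c e => by
      rw [abs_mul]
      exact mul_le_one₀ (abs_centeredCorr_le _ _) (abs_nonneg _) (abs_centeredCorr_le _ _)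
  set σ : ℝ := 2 / ((d : ℝ) * (d + 2)) with hσ
  have hσ0 : 0 ≤ σ := by positivity
  rw [integral_pi_update _ j (C := 1) (((hm i j).fun_mul (hm j k)).fun_mul
      ((hm i l).fun_mul (hm l k)))
    (fun x => by rw [abs_mul]; exact mul_le_one₀ (hb _ _ _ _) (abs_nonneg _) (hb _ _ _ _))]
  simp only [Function.update_self, Function.update_of_ne hij, Function.update_of_ne hjk.symm,
    Function.update_of_ne hjl.symm, integral_mul_const]
  have e1 : ∀ᵐ x ∂(gaussianRows n d),
      (∫ y, centeredCorr (x i) y * centeredCorr y (x k)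
        ∂(stdGaussian (EuclideanSpace ℝ (Fin d)))) *
        (centeredCorr (x i) (x l) * centeredCorr (x l) (x k)) =
      σ * (centeredCorr (x i) (x k) * (centeredCorr (x i) (x l) * centeredCorr (x l) (x k))) := by
    filter_upwards [ae_gaussianRows_ne_zero hd] with x hx
    simp_rw [centeredCorr_comm (x i)]
    rw [integral_centeredCorr_mul hd (hx i) (hx k), centeredCorr_comm (x k) (x i)]
    ring
  rw [integral_congr_ae e1, integral_const_mul,
    integral_pi_update _ l (C := 1) ((hm i k).fun_mul ((hm i l).fun_mul (hm l k)))
    (fun x => by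
      rw [abs_mul]; exact mul_le_one₀ (abs_centeredCorr_le _ _) (abs_nonneg _) (hb _ _ _ _))]
  simp only [Function.update_self, Function.update_of_ne hil, Function.update_of_ne hlk.symm,
    integral_const_mul]
  have e2 : ∀ᵐ x ∂(gaussianRows n d), centeredCorr (x i) (x k) *
      (∫ y, centeredCorr (x i) y * centeredCorr y (x k)
        ∂(stdGaussian (EuclideanSpace ℝ (Fin d)))) =
      σ * centeredCorr (x i) (x k) ^ 2 := by
    filter_upwards [ae_gaussianRows_ne_zero hd] with x hx
    simp_rw [centeredCorr_comm (x i)]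
    rw [integral_centeredCorr_mul hd (hx i) (hx k), centeredCorr_comm (x k) (x i)]
    ring
  rw [integral_congr_ae e2, integral_const_mul]
  calc σ * (σ * ∫ x, centeredCorr (x i) (x k) ^ 2 ∂(gaussianRows n d)) ≤ σ * (σ * σ) := by
        gcongr
        exact integral_centeredCorr_rows_sq_le hd hik
    _ = σ ^ 3 := by ring

/-- The matrix of centred squared correlations of the rows. -/
noncomputable def corrMatrix {n d : ℕ} (x : Fin n → EuclideanSpace ℝ (Fin d)) :
    Matrix (Fin n) (Fin n) ℝ :=
  centeredSq fun i => unitVec (x i)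

theorem corrMatrix_apply {n d : ℕ} (x : Fin n → EuclideanSpace ℝ (Fin d)) (i j : Fin n) :
    corrMatrix x i j = if i = j then 0 else centeredCorr (x i) (x j) := by
  simp [corrMatrix, centeredSq, centeredCorr]

theorem measurable_corrMatrix {n d : ℕ} (i j : Fin n) :
    Measurable fun x : Fin n → EuclideanSpace ℝ (Fin d) => corrMatrix x i j := by
  simp only [corrMatrix_apply]
  split_ifs
  · fun_prop
  · exact measurable_centeredCorr (measurable_pi_apply i) (measurable_pi_apply j)

theorem abs_corrMatrix_le {n d : ℕ} (x : Fin n → EuclideanSpace ℝ (Fin d)) (i j : Fin n) :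
    |corrMatrix x i j| ≤ 1 := by
  rw [corrMatrix_apply]
  split_ifs
  · simp
  · exact abs_centeredCorr_le _ _

theorem integral_corrMatrix_sq_entry_le {n d : ℕ} (hd : 0 < d) {i k : Fin n} (hik : i ≠ k) :
    ∫ x, (∑ j, corrMatrix x i j * corrMatrix x j k) ^ 2 ∂(gaussianRows n d) ≤
      n ^ 2 * (2 / ((d : ℝ) * (d + 2))) ^ 3 + n * (2 / ((d : ℝ) * (d + 2))) ^ 2 := by
  set σ : ℝ := 2 / ((d : ℝ) * (d + 2)) with hσ
  have hσ0 : 0 ≤ σ := by positivity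
  have hb : ∀ (x : Fin n → EuclideanSpace ℝ (Fin d)) (a b c e : Fin n),
      |corrMatrix x a b * corrMatrix x c e| ≤ 1 := fun x a b c e => by
    rw [abs_mul]
    exact mul_le_one₀ (abs_corrMatrix_le _ _ _) (abs_nonneg _) (abs_corrMatrix_le _ _ _)
  have hintg : ∀ j l : Fin n, Integrable (fun x : Fin n → EuclideanSpace ℝ (Fin d) =>
      corrMatrix x i j * corrMatrix x j k * (corrMatrix x i l * corrMatrix x l k))
      (gaussianRows n d) := fun j l => by
    refine Integrable.of_bound (C := 1) (Measurable.aestronglyMeasurable ?_)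
      (.of_forall fun x => ?_)
    · exact ((measurable_corrMatrix i j).mul (measurable_corrMatrix j k)).mul
        ((measurable_corrMatrix i l).mul (measurable_corrMatrix l k))
    · rw [Real.norm_eq_abs, abs_mul]
      exact mul_le_one₀ (hb _ _ _ _ _) (abs_nonneg _) (hb _ _ _ _ _)
  -- Expanding the square, distinct `j` and `l` give a genuine 4-cycle of size `σ ^ 3`, while `j =
  -- l` gives a doubled path of size `σ ^ 2`; the zero diagonal kills every other coincidence.
  have hent : ∀ j l : Fin n, ∫ x, corrMatrix x i j * corrMatrix x j k *
      (corrMatrix x i l * corrMatrix x l k) ∂(gaussianRows n d) ≤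
      σ ^ 3 + if j = l then σ ^ 2 else 0 := by
    intro j l
    have hpos : 0 ≤ σ ^ 3 + if j = l then σ ^ 2 else 0 := by split_ifs <;> positivity
    by_cases hij : i = j
    · simpa [corrMatrix_apply, hij] using hpos
    by_cases hil : i = l
    · simpa [corrMatrix_apply, hil] using hpos
    by_cases hjk : j = k
    · simpa [corrMatrix_apply, hjk] using hpos
    by_cases hlk : l = k
    · simpa [corrMatrix_apply, hlk] using hpos
    simp only [corrMatrix_apply, hij, hil, hjk, hlk, if_false]
    split_ifs with hjl
    · subst hjl
      have := integral_centeredCorr_path_sq_le hd hij hik hjk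
      refine le_trans (le_of_eq ?_) (this.trans (le_add_of_nonneg_left (by positivity)))
      exact integral_congr_ae (.of_forall fun x => by ring)
    · rw [add_zero]
      exact integral_centeredCorr_cycle_le hd hij hil hik hjl hjk hlk
  simp_rw [sq (∑ j, _), Finset.sum_mul_sum]
  rw [integral_finsetSum _ fun j _ => integrable_finsetSum _ fun l _ => hintg j l]
  simp_rw [integral_finsetSum _ fun l _ => hintg _ l]
  refine (Finset.sum_le_sum fun j _ => Finset.sum_le_sum fun l _ => hent j l).trans_eq ?_
  simp only [Finset.sum_add_distrib, Finset.sum_const, Finset.card_univ, Fintype.card_fin,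
    nsmul_eq_mul, Finset.sum_ite_eq, Finset.mem_univ, if_true]
  ring

theorem integral_inner_rows_pow_le {n d : ℕ} (hd : 0 < d) {i j : Fin n} (hij : i ≠ j) (p : ℕ) :
    ∫ x, inner ℝ (unitVec (x i)) (unitVec (x j)) ^ (2 * p) ∂(gaussianRows n d) ≤
      (∫ x, x ^ (2 * p) ∂(gaussianReal 0 1)) / (d : ℝ) ^ p := by
  have hu := measurable_unitVec (d := d)
  rw [integral_pi_update _ i (C := 1) (by fun_prop) (fun x => by
    rw [pow_mul, abs_pow]
    exact pow_le_one₀ (abs_nonneg _) (by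
      rw [abs_of_nonneg (sq_nonneg _)]; exact inner_unitVec_sq_le_one _ _))]
  simp only [Function.update_self, Function.update_of_ne hij.symm]
  refine (integral_mono_of_nonneg (.of_forall fun x => integral_nonneg fun y => ?_)
    (integrable_const ((∫ x, x ^ (2 * p) ∂(gaussianReal 0 1)) / (d : ℝ) ^ p)) ?_).trans_eq
    (by simp)
  · simp only [Pi.zero_apply]; rw [pow_mul]; positivity
  · filter_upwards [ae_gaussianRows_ne_zero hd] with x hx
    exact integral_inner_unitVec_even_pow_le hd (norm_unitVec (hx j)) p

/-! ### The good event and its probability. -/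

/-- The sum of the `2p`-th powers of the correlations between distinct rows. -/
noncomputable def corrPowSum {n d : ℕ} (p : ℕ) (x : Fin n → EuclideanSpace ℝ (Fin d)) : ℝ :=
  ∑ i, ∑ j, if i = j then 0 else inner ℝ (unitVec (x i)) (unitVec (x j)) ^ (2 * p)

/-- The squared Frobenius norm of the off-diagonal part of the square of `corrMatrix x`. -/
noncomputable def corrSqOffDiag {n d : ℕ} (x : Fin n → EuclideanSpace ℝ (Fin d)) : ℝ :=
  ∑ i, ∑ k, (if i = k then 0 else ∑ j, corrMatrix x i j * corrMatrix x j k) ^ 2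

/-- The total deviation of the squared row norms from `d`. -/
noncomputable def normDeviation {n d : ℕ} (x : Fin n → EuclideanSpace ℝ (Fin d)) : ℝ :=
  ∑ i, (1 - ‖x i‖ ^ 2 / (d : ℝ)) ^ 2

/-- The matrices whose rows are nearly orthogonal in the quantitative sense used below. -/
def goodRows (n d p : ℕ) (θ f κ : ℝ) : Set (Fin n → EuclideanSpace ℝ (Fin d)) :=
  {x | (∀ i, x i ≠ 0) ∧ corrPowSum p x < θ ^ p ∧ corrSqOffDiag x < f ^ 2 ∧
    normDeviation x < κ * n}

theorem measurable_corrPowSum {n d : ℕ} (p : ℕ) :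
    Measurable (corrPowSum p : (Fin n → EuclideanSpace ℝ (Fin d)) → ℝ) := by
  have hu := measurable_unitVec (d := d)
  refine Finset.measurable_fun_sum _ fun i _ => Finset.measurable_fun_sum _ fun j _ => ?_
  split_ifs <;> fun_prop

theorem measurable_corrSqOffDiag {n d : ℕ} :
    Measurable (corrSqOffDiag : (Fin n → EuclideanSpace ℝ (Fin d)) → ℝ) := by
  refine Finset.measurable_fun_sum _ fun i _ => Finset.measurable_fun_sum _ fun j _ => ?_
  split_ifs
  · fun_prop
  · exact (Finset.measurable_fun_sum _ fun l _ =>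
      (measurable_corrMatrix i l).mul (measurable_corrMatrix l j)).pow_const 2

theorem measurable_normDeviation {n d : ℕ} :
    Measurable (normDeviation : (Fin n → EuclideanSpace ℝ (Fin d)) → ℝ) := by
  unfold normDeviation; fun_prop

theorem measurableSet_goodRows (n d p : ℕ) (θ f κ : ℝ) :
    MeasurableSet (goodRows n d p θ f κ) := by
  have h0 : MeasurableSet {x : Fin n → EuclideanSpace ℝ (Fin d) | ∀ i, x i ≠ 0} := by
    rw [Set.ofPred_forall]
    refine MeasurableSet.iInter fun i => ?_
    exact (measurable_pi_apply (X := fun _ : Fin n => EuclideanSpace ℝ (Fin d)) i)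
      (MeasurableSet.singleton (0 : EuclideanSpace ℝ (Fin d))).compl
  exact h0.inter ((measurableSet_lt (measurable_corrPowSum p) measurable_const).inter
    ((measurableSet_lt measurable_corrSqOffDiag measurable_const).inter
      (measurableSet_lt measurable_normDeviation measurable_const)))

theorem integral_corrPowSum_le {n d : ℕ} (hd : 0 < d) (p : ℕ) :
    Integrable (corrPowSum p) (gaussianRows n d) ∧
    ∫ x, corrPowSum p x ∂(gaussianRows n d) ≤
      n ^ 2 * ((∫ x, x ^ (2 * p) ∂(gaussianReal 0 1)) / (d : ℝ) ^ p) := by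
  have hu := measurable_unitVec (d := d)
  have hK : 0 ≤ (∫ x, x ^ (2 * p) ∂(gaussianReal 0 1)) / (d : ℝ) ^ p :=
    div_nonneg (integral_nonneg fun x => by simp only [Pi.zero_apply]; rw [pow_mul]; positivity)
      (by positivity)
  have hintg : ∀ i j : Fin n, Integrable (fun x : Fin n → EuclideanSpace ℝ (Fin d) =>
      if i = j then 0 else inner ℝ (unitVec (x i)) (unitVec (x j)) ^ (2 * p))
      (gaussianRows n d) := fun i j => by
    split_ifs
    · exact integrable_const _
    · refine Integrable.of_bound (C := 1) (Measurable.aestronglyMeasurable (by fun_prop))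
        (.of_forall fun x => ?_)
      rw [pow_mul, norm_pow, Real.norm_of_nonneg (sq_nonneg _)]
      exact pow_le_one₀ (sq_nonneg _) (inner_unitVec_sq_le_one _ _)
  unfold corrPowSum
  refine ⟨integrable_finsetSum _ fun i _ => integrable_finsetSum _ fun j _ => hintg i j, ?_⟩
  rw [integral_finsetSum _ fun j _ => integrable_finsetSum _ fun l _ => hintg j l]
  simp_rw [integral_finsetSum _ fun l _ => hintg _ l]
  calc _ ≤ ∑ _i : Fin n, ∑ _j : Fin n, (∫ x, x ^ (2 * p) ∂(gaussianReal 0 1)) / (d : ℝ) ^ p := by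
        refine Finset.sum_le_sum fun i _ => Finset.sum_le_sum fun j _ => ?_
        split_ifs with h
        · simpa using hK
        · exact integral_inner_rows_pow_le hd h p
    _ = _ := by
        simp only [Finset.sum_const, Finset.card_univ, Fintype.card_fin, nsmul_eq_mul]; ring

theorem integral_corrSqOffDiag_le {n d : ℕ} (hd : 0 < d) :
    Integrable corrSqOffDiag (gaussianRows n d) ∧
    ∫ x, corrSqOffDiag x ∂(gaussianRows n d) ≤
      n ^ 2 * (n ^ 2 * (2 / ((d : ℝ) * (d + 2))) ^ 3 + n * (2 / ((d : ℝ) * (d + 2))) ^ 2) := by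
  have hintg : ∀ i k : Fin n, Integrable (fun x : Fin n → EuclideanSpace ℝ (Fin d) =>
      (if i = k then 0 else ∑ j, corrMatrix x i j * corrMatrix x j k) ^ 2)
      (gaussianRows n d) := fun i k => by
    split_ifs
    · exact integrable_const _
    · refine Integrable.of_bound (C := (n : ℝ) ^ 2) (Measurable.aestronglyMeasurable ?_)
        (.of_forall fun x => ?_)
      · exact (Finset.measurable_fun_sum _ fun l _ =>
          (measurable_corrMatrix i l).mul (measurable_corrMatrix l k)).pow_const 2
      · rw [norm_pow, Real.norm_eq_abs]
        refine pow_le_pow_left₀ (abs_nonneg _) ((Finset.abs_sum_le_sum_abs _ _).trans ?_) 2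
        refine (Finset.sum_le_sum fun j _ => (?_ : _ ≤ (1 : ℝ))).trans_eq (by simp)
        rw [abs_mul]
        exact mul_le_one₀ (abs_corrMatrix_le _ _ _) (abs_nonneg _) (abs_corrMatrix_le _ _ _)
  unfold corrSqOffDiag
  refine ⟨integrable_finsetSum _ fun i _ => integrable_finsetSum _ fun j _ => hintg i j, ?_⟩
  rw [integral_finsetSum _ fun j _ => integrable_finsetSum _ fun l _ => hintg j l]
  simp_rw [integral_finsetSum _ fun l _ => hintg _ l]
  calc _ ≤ ∑ _i : Fin n, ∑ _k : Fin n,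
        ((n : ℝ) ^ 2 * (2 / ((d : ℝ) * (d + 2))) ^ 3 + n * (2 / ((d : ℝ) * (d + 2))) ^ 2) := by
        refine Finset.sum_le_sum fun i _ => Finset.sum_le_sum fun j _ => ?_
        by_cases h : i = j
        · simp only [h, if_true, zero_pow two_ne_zero, integral_zero]; positivity
        · simp only [h, if_false]
          exact integral_corrMatrix_sq_entry_le hd h
    _ = _ := by
        simp only [Finset.sum_const, Finset.card_univ, Fintype.card_fin, nsmul_eq_mul]; ring

theorem integral_normDeviation {n d : ℕ} (hd : 0 < d) :
    Integrable normDeviation (gaussianRows n d) ∧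
    ∫ x, normDeviation x ∂(gaussianRows n d) = n * (2 / (d : ℝ)) := by
  have hg : Integrable (fun g : EuclideanSpace ℝ (Fin d) => (1 - ‖g‖ ^ 2 / (d : ℝ)) ^ 2)
      (stdGaussian (EuclideanSpace ℝ (Fin d))) := by
    have e1 : ∀ g : EuclideanSpace ℝ (Fin d), (1 - ‖g‖ ^ 2 / (d : ℝ)) ^ 2 =
        1 - 2 / (d : ℝ) * ‖g‖ ^ 2 + (1 / (d : ℝ) ^ 2) * ‖g‖ ^ 4 := fun g => by ring
    simp_rw [e1]
    exact ((integrable_const _).sub ((integrable_stdGaussian_norm_pow d 2).const_mul _)).add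
      ((integrable_stdGaussian_norm_pow d 4).const_mul _)
  have hp := fun i : Fin n =>
    measurePreserving_eval (fun _ : Fin n => stdGaussian (EuclideanSpace ℝ (Fin d))) i
  have hintg : ∀ i : Fin n, Integrable (fun x : Fin n → EuclideanSpace ℝ (Fin d) =>
      (1 - ‖x i‖ ^ 2 / (d : ℝ)) ^ 2) (gaussianRows n d) := fun i =>
    (hp i).integrable_comp_of_integrable hg
  unfold normDeviation
  refine ⟨integrable_finsetSum _ fun i _ => hintg i, ?_⟩
  rw [integral_finsetSum _ fun i _ => hintg i]
  have : ∀ i : Fin n, ∫ x : Fin n → EuclideanSpace ℝ (Fin d), (1 - ‖x i‖ ^ 2 / (d : ℝ)) ^ 2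
      ∂(gaussianRows n d) = 2 / (d : ℝ) := fun i => by
    rw [← integral_norm_sq_div_sub_one_sq hd, ← (hp i).map_eq,
      integral_map (hp i).measurable.aemeasurable (by rw [(hp i).map_eq]; exact hg.1)]
  simp [this]

theorem measureReal_ge_le_div {α : Type*} [MeasurableSpace α] {μ : Measure α}
    {F : α → ℝ} (hF : Integrable F μ) (h0 : ∀ x, 0 ≤ F x) {c B : ℝ} (hc : 0 < c)
    (hB : ∫ x, F x ∂μ ≤ B) : μ.real {x | c ≤ F x} ≤ B / c := by
  rw [le_div_iff₀ hc, mul_comm]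
  exact (mul_meas_ge_le_integral_of_nonneg (.of_forall h0) hF c).trans hB

/-- Markov's inequality for each of the three statistics and a union bound; vanishing rows have
probability zero. -/
theorem measureReal_goodRows_ge {n d : ℕ} (hn : 0 < n) (hd : 0 < d) (p : ℕ) {θ f κ : ℝ}
    (hθ : 0 < θ) (hf : 0 < f) (hκ : 0 < κ) :
    1 - (n ^ 2 * ((∫ x, x ^ (2 * p) ∂(gaussianReal 0 1)) / (d : ℝ) ^ p) / θ ^ p
      + n ^ 2 * (n ^ 2 * (2 / ((d : ℝ) * (d + 2))) ^ 3
        + n * (2 / ((d : ℝ) * (d + 2))) ^ 2) / f ^ 2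
      + n * (2 / (d : ℝ)) / (κ * n)) ≤ (gaussianRows n d).real (goodRows n d p θ f κ) := by
  have a1 := measureReal_ge_le_div (integral_corrPowSum_le (n := n) hd p).1
    (fun x => Finset.sum_nonneg fun i _ => Finset.sum_nonneg fun j _ => by
      split_ifs
      · exact le_rfl
      · rw [pow_mul]; positivity)
    (pow_pos hθ p) (integral_corrPowSum_le hd p).2
  have a2 := measureReal_ge_le_div (integral_corrSqOffDiag_le (n := n) hd).1
    (fun x => Finset.sum_nonneg fun i _ => Finset.sum_nonneg fun j _ => sq_nonneg _)
    (pow_pos hf 2) (integral_corrSqOffDiag_le hd).2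
  have a3 := measureReal_ge_le_div (integral_normDeviation (n := n) hd).1
    (fun x => Finset.sum_nonneg fun i _ => sq_nonneg _)
    (mul_pos hκ (Nat.cast_pos.2 hn)) (integral_normDeviation hd).2.le
  have a4 : (gaussianRows n d).real {x | ∀ i, x i ≠ 0}ᶜ = 0 := by
    rw [measureReal_eq_zero_iff]
    exact ae_iff.1 (ae_gaussianRows_ne_zero hd)
  have hsub : (goodRows n d p θ f κ)ᶜ ⊆ ({x | θ ^ p ≤ corrPowSum p x} ∪
      {x | f ^ 2 ≤ corrSqOffDiag x}) ∪ ({x | κ * n ≤ normDeviation x} ∪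
      {x | ∀ i, x i ≠ 0}ᶜ) := by
    intro x hx
    by_contra hcon
    simp only [Set.mem_union, Set.mem_ofPred_eq, Set.mem_compl_iff, not_or, not_le,
      not_not] at hcon
    exact hx ⟨hcon.2.2, hcon.1.1, hcon.1.2, hcon.2.1⟩
  have b1 := measureReal_mono (μ := gaussianRows n d) hsub
  have b2 := measureReal_union_le (μ := gaussianRows n d) ({x | θ ^ p ≤ corrPowSum p x} ∪
      {x | f ^ 2 ≤ corrSqOffDiag x}) ({x | κ * n ≤ normDeviation x} ∪ {x | ∀ i, x i ≠ 0}ᶜ)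
  have b3 := measureReal_union_le (μ := gaussianRows n d) {x | θ ^ p ≤ corrPowSum p x}
    {x | f ^ 2 ≤ corrSqOffDiag x}
  have b4 := measureReal_union_le (μ := gaussianRows n d) {x | κ * n ≤ normDeviation x}
    {x | ∀ i, x i ≠ 0}ᶜ
  have b5 := probReal_compl_eq_one_sub (μ := gaussianRows n d)
    (measurableSet_goodRows n d p θ f κ)
  linarith

/-! ### A solution of large value from good rows. -/

theorem exists_sos4_of_goodRows {n d p : ℕ} (hn : 0 < n) (hd : 0 < d) (hp : p ≠ 0)
    {θ f κ η τ : ℝ} (hθ : 0 ≤ θ)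
    (hf : 0 ≤ f) (hη : 0 < η) (hη1 : η ≤ 1) (hητ : η ≤ τ) (hdθ : 1 / (d : ℝ) ≤ θ)
    (hτ : 2 * θ + 2 * n * θ ^ 2 + 4 * η * n * θ ≤ τ ^ 2)
    (hdn : (1 + 3 / η) * (n / (d : ℝ) ^ 2) ≤ η / 2) (hl : n * θ ^ 2 + f ≤ (η / 3) ^ 2)
    {x : Fin n → EuclideanSpace ℝ (Fin d)} (hx : x ∈ goodRows n d p θ f κ)
    (V : Submodule ℝ (EuclideanSpace ℝ (Fin n)))
    (hV : ∀ a, WithLp.toLp 2 (fun i => x i a) ∈ V) :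
    ∃ M : Matrix (SmallSet n) (SmallSet n) ℝ,
      IsSoS4 M ∧ (1 + τ)⁻¹ * (1 - κ) ≤ (1 / (n : ℝ)) * sosValue (projMatrix V) M := by
  obtain ⟨hx0, hx1, hx2, hx3⟩ := hx
  set v : Fin n → EuclideanSpace ℝ (Fin d) := fun i => unitVec (x i) with hv
  have hv1 : ∀ i, ‖v i‖ = 1 := fun i => norm_unitVec (hx0 i)
  have hcorr : ∀ i j, i ≠ j → inner ℝ (v i) (v j) ^ 2 ≤ θ := by
    intro i j hij
    have h0 : ∀ i j : Fin n, (0 : ℝ) ≤ if i = j then 0 else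
        inner ℝ (unitVec (x i)) (unitVec (x j)) ^ (2 * p) := fun i j => by
      split_ifs
      · exact le_rfl
      · rw [pow_mul]; positivity
    have h1 : inner ℝ (v i) (v j) ^ (2 * p) ≤ corrPowSum p x := by
      refine le_trans ?_ (Finset.single_le_sum
        (f := fun i => ∑ j, if i = j then (0 : ℝ) else
          inner ℝ (unitVec (x i)) (unitVec (x j)) ^ (2 * p))
        (fun i _ => Finset.sum_nonneg fun j _ => h0 i j) (Finset.mem_univ i))
      refine le_trans ?_ (Finset.single_le_sum (fun j _ => h0 i j) (Finset.mem_univ j))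
      rw [if_neg hij]
    -- Even powers are nonnegative, so one correlation is dominated by the whole power sum.
    have h2 : (inner ℝ (v i) (v j) ^ 2) ^ p ≤ θ ^ p := by
      rw [← pow_mul]; exact (h1.trans hx1.le)
    exact (pow_le_pow_iff_left₀ (sq_nonneg _) hθ hp).1 h2
  have hYsymm : ∀ i j, corrMatrix x i j = corrMatrix x j i := fun i j => by
    rw [corrMatrix_apply, corrMatrix_apply, centeredCorr_comm]
    simp [eq_comm]
  have hYrow : ∀ i, ∑ j, corrMatrix x i j ^ 2 ≤ n * θ ^ 2 := fun i => by
    refine (Finset.sum_le_sum fun j _ => (?_ : _ ≤ θ ^ 2)).trans_eq (by simp)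
    rw [corrMatrix_apply]
    split_ifs with h
    · simpa using sq_nonneg θ
    · have h1 := hcorr i j h
      have h2 : (0 : ℝ) ≤ 1 / d := by positivity
      rw [← sq_abs]
      refine pow_le_pow_left₀ (abs_nonneg _) ?_ 2
      unfold centeredCorr
      rw [abs_le]
      constructor
      -- The lower side of the absolute value is where `1 / d ≤ θ` is needed.
      · have := sq_nonneg (inner ℝ (v i) (v j) : ℝ)
        simp only [hv] at this
        linarith
      · simp only [hv] at h1
        linarith
  have hquart : QuarticBound (Matrix.gram ℝ v) η :=
    quarticBound_gram hd v hv1 hη hη1 hdn fun b =>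
      quadForm_le_of_sq (corrMatrix x) hYsymm (by positivity) hf hYrow hx2.le hl b
  obtain ⟨M, hM, hMv⟩ := exists_isSoS4_of_quarticBound (X := Matrix.gram ℝ v)
    (Matrix.posSemidef_gram ℝ v) (fun i => by
      rw [Matrix.gram_apply, real_inner_self_eq_norm_sq, hv1, one_pow]) hη.le hητ hθ
    (fun i j hij => hcorr i j hij) hquart hτ
  refine ⟨M, hM, ?_⟩
  have hτ0 : 0 < 1 + τ := by linarith
  have hval : sosValue (projMatrix V) M =
      (1 + τ)⁻¹ * (∑ i, ∑ j, projMatrix V i j * Matrix.gram ℝ v i j)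
        + (1 - (1 + τ)⁻¹) * ∑ i, projMatrix V i i := by
    unfold sosValue
    simp only [hMv, mul_add, Finset.sum_add_distrib, Finset.mul_sum, mul_ite, mul_zero,
      Finset.sum_ite_eq, Finset.mem_univ, if_true]
    congr 1
    · exact Finset.sum_congr rfl fun i _ => Finset.sum_congr rfl fun j _ => by ring
    · exact Finset.sum_congr rfl fun i _ => by ring
  -- The comparison vectors are the rows scaled by `1 / √d`; their columns stay in `V`.
  have hproj := sum_projMatrix_mul_gram_ge V v (fun i => (√(d : ℝ))⁻¹ • x i) fun a => by
    have := V.smul_mem (√(d : ℝ))⁻¹ (hV a)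
    convert this using 1
    ext i; simp
  have hdev : ∑ i, ‖v i - (√(d : ℝ))⁻¹ • x i‖ ^ 2 ≤ normDeviation x := by
    refine Finset.sum_le_sum fun i _ => ?_
    have hs : 0 < √(d : ℝ) := Real.sqrt_pos.2 (by positivity)
    have hs2 : √(d : ℝ) ^ 2 = d := Real.sq_sqrt (by positivity)
    have e1 : v i - (√(d : ℝ))⁻¹ • x i = (1 - ‖x i‖ / √(d : ℝ)) • v i := by
      have : x i = ‖x i‖ • v i := by
        simp only [hv, unitVec]
        rw [smul_smul, mul_inv_cancel₀ (norm_ne_zero_iff.2 (hx0 i)), one_smul]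
      conv_lhs => rw [this]
      rw [smul_smul, sub_smul, one_smul, div_eq_inv_mul]
    rw [e1, norm_smul, hv1, mul_one, Real.norm_eq_abs, sq_abs]
    set t := ‖x i‖ / √(d : ℝ) with ht
    have ht0 : 0 ≤ t := by positivity
    have e2 : ‖x i‖ ^ 2 / (d : ℝ) = t ^ 2 := by rw [ht, div_pow, hs2]
    rw [e2]
    -- With `t ≥ 0` the factor `(1 + t) ^ 2` is at least 1, so the deviation of the norm is bounded
    -- by that of its square, whose moments are polynomial.
    have e3 : (1 - t ^ 2) ^ 2 = (1 - t) ^ 2 * (1 + t) ^ 2 := by ring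
    rw [e3]
    exact le_mul_of_one_le_right (sq_nonneg _) (by nlinarith)
  have hsum : ∑ i, ‖v i‖ ^ 2 = (n : ℝ) := by simp [hv1]
  have hdiag : 0 ≤ (1 - (1 + τ)⁻¹) * ∑ i, projMatrix V i i :=
    mul_nonneg (sub_nonneg.2 (inv_le_one_of_one_le₀ (by linarith)))
      (Finset.sum_nonneg fun i _ => projMatrix_diag_nonneg V i)
  have hnpos : (0 : ℝ) < n := Nat.cast_pos.2 hn
  have hmain : (n : ℝ) * (1 - κ) ≤ ∑ i, ∑ j, projMatrix V i j * Matrix.gram ℝ v i j := by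
    linarith
  rw [hval, one_div, le_inv_mul_iff₀ hnpos]
  have := mul_le_mul_of_nonneg_left hmain (inv_nonneg.2 hτ0.le)
  linarith

/-! ### From Gaussian matrices to the invariant law on the Grassmannian. -/

/-- Allows the columns of a matrix of deficient rank to be placed in a `d`-dimensional subspace, so
that almost sure full rank is never needed. -/
theorem exists_submodule_ge_finrank_eq {E : Type*} [AddCommGroup E] [Module ℝ E]
    [FiniteDimensional ℝ E] {d : ℕ} (hd : d ≤ Module.finrank ℝ E) (U : Submodule ℝ E)
    (hU : Module.finrank ℝ U ≤ d) : ∃ W : Submodule ℝ E, U ≤ W ∧ Module.finrank ℝ W = d := by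
  induction hk : d - Module.finrank ℝ U generalizing U with
  | zero => exact ⟨U, le_rfl, by omega⟩
  | succ k ih =>
    have hlt : Module.finrank ℝ U < Module.finrank ℝ E := by omega
    have hne : U ≠ ⊤ := by rintro rfl; simp at hlt
    obtain ⟨v, -, hv⟩ := SetLike.exists_of_lt (lt_top_iff_ne_top.2 hne)
    have hv0 : v ≠ 0 := by rintro rfl; exact hv U.zero_mem
    have hfin : Module.finrank ℝ ↥(U ⊔ ℝ ∙ v) = Module.finrank ℝ U + 1 := by
      have h1 := Submodule.finrank_sup_add_finrank_inf_eq U (ℝ ∙ v)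
      have h2 : U ⊓ (ℝ ∙ v) = ⊥ := by
        rw [← disjoint_iff]
        exact Submodule.disjoint_span_singleton_of_notMem hv
      rw [h2, finrank_bot, finrank_span_singleton hv0] at h1
      omega
    obtain ⟨W, hW1, hW2⟩ := ih (U ⊔ ℝ ∙ v) (by omega) (by omega)
    exact ⟨W, le_sup_left.trans hW1, hW2⟩

/-- An isometry between the two subspaces, built from orthonormal bases, extends to the whole space.
-/
theorem Gr.exists_rotate_eq {n d : ℕ} (V W : Gr n d) : ∃ U, Gr.rotate U V = W := by
  have hfin : Module.finrank ℝ V.1 = Module.finrank ℝ W.1 := V.2.trans W.2.symm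
  let e : V.1 ≃ₗᵢ[ℝ] W.1 := (stdOrthonormalBasis ℝ V.1).equiv (stdOrthonormalBasis ℝ W.1)
    (finCongr hfin)
  let L := W.1.subtypeₗᵢ.comp e.toLinearIsometry
  let U := L.extend.toLinearIsometryEquiv rfl
  refine ⟨U, Subtype.ext ?_⟩
  refine Submodule.eq_of_le_of_finrank_eq ?_ ((Gr.rotate U V).2.trans W.2.symm)
  rintro _ ⟨x, hx, rfl⟩
  have : U x = L ⟨x, hx⟩ := L.extend_apply ⟨x, hx⟩
  change U x ∈ W.1
  rw [this]
  exact (e ⟨x, hx⟩).2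

theorem starProjection_apply_eq_sum {n : ℕ} (V : Submodule ℝ (EuclideanSpace ℝ (Fin n)))
    (y : EuclideanSpace ℝ (Fin n)) (k : Fin n) :
    V.starProjection y k = ∑ l, y l * projMatrix V k l := by
  have hc : y = ∑ j, y j • EuclideanSpace.single j (1 : ℝ) := by
    have := (EuclideanSpace.basisFun (Fin n) ℝ).sum_repr y
    simpa using this.symm
  conv_lhs => rw [hc, map_sum]
  simp [projMatrix]

theorem linearIsometryEquiv_apply_eq_sum {n : ℕ}
    (U : EuclideanSpace ℝ (Fin n) ≃ₗᵢ[ℝ] EuclideanSpace ℝ (Fin n))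
    (y : EuclideanSpace ℝ (Fin n)) (i : Fin n) :
    U y i = ∑ k, y k * U (EuclideanSpace.single k 1) i := by
  have hc : y = ∑ j, y j • EuclideanSpace.single j (1 : ℝ) := by
    have := (EuclideanSpace.basisFun (Fin n) ℝ).sum_repr y
    simpa using this.symm
  conv_lhs => rw [hc, map_sum]
  simp

theorem projMatrix_rotate {n d : ℕ}
    (U : EuclideanSpace ℝ (Fin n) ≃ₗᵢ[ℝ] EuclideanSpace ℝ (Fin n)) (V : Gr n d) (i j : Fin n) :
    projMatrix (Gr.rotate U V).1 i j =
      ∑ k, (∑ l, U.symm (EuclideanSpace.single j 1) l * projMatrix V.1 k l) *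
        U (EuclideanSpace.single k 1) i := by
  have h : projMatrix (Gr.rotate U V).1 i j = (Gr.rotate U V).1.starProjection
    (EuclideanSpace.single j 1) i := rfl
  rw [h, Gr.rotate, Submodule.starProjection_map_apply, linearIsometryEquiv_apply_eq_sum]
  simp_rw [starProjection_apply_eq_sum]

/-- The action of an orthogonal transformation of `ℝⁿ` on the columns of an `n × d` matrix. -/
noncomputable def rotateRows {n d : ℕ}
    (U : EuclideanSpace ℝ (Fin n) ≃ₗᵢ[ℝ] EuclideanSpace ℝ (Fin n))
    (x : Fin n → EuclideanSpace ℝ (Fin d)) : Fin n → EuclideanSpace ℝ (Fin d) :=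
  fun i => WithLp.toLp 2 fun a => U (WithLp.toLp 2 fun k => x k a) i

theorem rotateRows_col {n d : ℕ}
    (U : EuclideanSpace ℝ (Fin n) ≃ₗᵢ[ℝ] EuclideanSpace ℝ (Fin n))
    (x : Fin n → EuclideanSpace ℝ (Fin d)) (a : Fin d) :
    (WithLp.toLp 2 fun i => rotateRows U x i a) = U (WithLp.toLp 2 fun i => x i a) := by
  ext i; simp [rotateRows]

theorem rotateRows_symm_rotateRows {n d : ℕ}
    (U : EuclideanSpace ℝ (Fin n) ≃ₗᵢ[ℝ] EuclideanSpace ℝ (Fin n))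
    (x : Fin n → EuclideanSpace ℝ (Fin d)) : rotateRows U.symm (rotateRows U x) = x := by
  ext i a
  change U.symm (WithLp.toLp 2 fun k => rotateRows U x k a) i = x i a
  rw [rotateRows_col, U.symm_apply_apply]

theorem sum_norm_rotateRows_sq {n d : ℕ}
    (U : EuclideanSpace ℝ (Fin n) ≃ₗᵢ[ℝ] EuclideanSpace ℝ (Fin n))
    (x : Fin n → EuclideanSpace ℝ (Fin d)) :
    ∑ i, ‖rotateRows U x i‖ ^ 2 = ∑ i, ‖x i‖ ^ 2 := by
  have h1 : ∀ u : Fin n → EuclideanSpace ℝ (Fin d),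
      ∑ i, ‖u i‖ ^ 2 = ∑ a, ‖(WithLp.toLp 2 (fun i => u i a) : EuclideanSpace ℝ (Fin n))‖ ^ 2 := by
    intro u
    simp only [EuclideanSpace.norm_sq_eq, Real.norm_eq_abs, sq_abs]
    rw [Finset.sum_comm]
  rw [h1, h1]
  simp_rw [rotateRows_col, U.norm_map]

/-- `rotateRows` as a linear isometry for the Frobenius norm. -/
noncomputable def rotateRowsIsometry {n d : ℕ}
    (U : EuclideanSpace ℝ (Fin n) ≃ₗᵢ[ℝ] EuclideanSpace ℝ (Fin n)) :
    PiLp 2 (fun _ : Fin n => EuclideanSpace ℝ (Fin d)) ≃ₗᵢ[ℝ]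
      PiLp 2 (fun _ : Fin n => EuclideanSpace ℝ (Fin d)) where
  toFun x := WithLp.toLp 2 (rotateRows U x.ofLp)
  invFun x := WithLp.toLp 2 (rotateRows U.symm x.ofLp)
  left_inv x := by simp [rotateRows_symm_rotateRows]
  right_inv x := by
    have := rotateRows_symm_rotateRows U.symm x.ofLp
    rw [LinearIsometryEquiv.symm_symm] at this
    simp [this]
  map_add' x y := by
    ext i a
    have : (WithLp.toLp 2 fun k => x.ofLp k a + y.ofLp k a : EuclideanSpace ℝ (Fin n)) =
      WithLp.toLp 2 (fun k => x.ofLp k a) + WithLp.toLp 2 fun k => y.ofLp k a := rfl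
    simp [rotateRows, this]
  map_smul' c x := by
    ext i a
    have : (WithLp.toLp 2 fun k => c * x.ofLp k a : EuclideanSpace ℝ (Fin n)) =
      c • WithLp.toLp 2 (fun k => x.ofLp k a) := rfl
    simp [rotateRows, this]
  norm_map' x := by
    have h : ∀ y : PiLp 2 (fun _ : Fin n => EuclideanSpace ℝ (Fin d)),
        ‖y‖ ^ 2 = ∑ i, ‖y.ofLp i‖ ^ 2 := fun y => PiLp.norm_sq_eq_of_L2 _ y
    refine (sq_eq_sq₀ (norm_nonneg _) (norm_nonneg _)).1 ?_
    rw [h, h]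
    exact sum_norm_rotateRows_sq U x.ofLp

/-- Independent standard rows form a standard Gaussian for the Frobenius norm, since the
characteristic functions multiply. Invariance under `rotateRows` then follows from that of
`stdGaussian` under isometries. -/
theorem gaussianRows_map_toLp (n d : ℕ) :
    (gaussianRows n d).map (WithLp.toLp 2) =
      stdGaussian (PiLp 2 fun _ : Fin n => EuclideanSpace ℝ (Fin d)) := by
  apply Measure.ext_of_charFun
  ext t
  simp_rw [charFun_stdGaussian, charFun_pi, charFun_stdGaussian, ← Complex.exp_sum]
  congr 1
  have := PiLp.norm_sq_eq_of_L2 _ t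
  rw [← Complex.ofReal_pow, this]
  push_cast
  rw [← Finset.sum_div, Finset.sum_neg_distrib]

theorem measurable_rotateRows {n d : ℕ}
    (U : EuclideanSpace ℝ (Fin n) ≃ₗᵢ[ℝ] EuclideanSpace ℝ (Fin n)) :
    Measurable (rotateRows U : (Fin n → EuclideanSpace ℝ (Fin d)) → _) := by
  unfold rotateRows; fun_prop

theorem gaussianRows_map_rotateRows {n d : ℕ}
    (U : EuclideanSpace ℝ (Fin n) ≃ₗᵢ[ℝ] EuclideanSpace ℝ (Fin n)) :
    (gaussianRows n d).map (rotateRows U) = gaussianRows n d := by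
  have h1 := stdGaussian_map (rotateRowsIsometry (d := d) U)
  rw [← gaussianRows_map_toLp, Measure.map_map (by fun_prop) (by fun_prop)] at h1
  have h2 := congrArg (Measure.map (WithLp.ofLp (p := 2))) h1
  rw [Measure.map_map (by fun_prop) (by fun_prop), Measure.map_map (by fun_prop) (by fun_prop)]
    at h2
  have e1 : (WithLp.ofLp (p := 2) ∘ ⇑(rotateRowsIsometry (d := d) U) ∘ WithLp.toLp 2) =
      (rotateRows U : (Fin n → EuclideanSpace ℝ (Fin d)) → _) := rfl
  have e2 : (WithLp.ofLp (p := 2) ∘ WithLp.toLp 2) =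
      (id : (Fin n → EuclideanSpace ℝ (Fin d)) → _) := rfl
  rwa [e1, e2, Measure.map_id] at h2

instance EuclideanSpace.instContinuousStarEnd (n : ℕ) :
    ContinuousStar (EuclideanSpace ℝ (Fin n) →L[ℝ] EuclideanSpace ℝ (Fin n)) :=
  ⟨(ContinuousLinearMap.adjoint (𝕜 := ℝ) (E := EuclideanSpace ℝ (Fin n))
    (F := EuclideanSpace ℝ (Fin n))).continuous⟩

/-- The orthogonal group of `ℝⁿ`. -/
abbrev OrthGroup (n : ℕ) : Type :=
  unitary (EuclideanSpace ℝ (Fin n) →L[ℝ] EuclideanSpace ℝ (Fin n))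

noncomputable instance OrthGroup.instMeasurableSpace (n : ℕ) : MeasurableSpace (OrthGroup n) :=
  borel _

instance OrthGroup.instBorelSpace (n : ℕ) : BorelSpace (OrthGroup n) := ⟨rfl⟩

instance OrthGroup.instCompactSpace (n : ℕ) : CompactSpace (OrthGroup n) := by
  refine (isCompact_iff_compactSpace (s := (unitary (EuclideanSpace ℝ (Fin n) →L[ℝ]
    EuclideanSpace ℝ (Fin n)) :
    Set (EuclideanSpace ℝ (Fin n) →L[ℝ] EuclideanSpace ℝ (Fin n))))).1 ?_
  have : ProperSpace (EuclideanSpace ℝ (Fin n) →L[ℝ] EuclideanSpace ℝ (Fin n)) :=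
    FiniteDimensional.proper ℝ _
  refine (isCompact_closedBall
    (0 : EuclideanSpace ℝ (Fin n) →L[ℝ] EuclideanSpace ℝ (Fin n)) 1).of_isClosed_subset
    isClosed_unitary fun u hu => ?_
  rw [mem_closedBall_zero_iff]
  refine ContinuousLinearMap.opNorm_le_bound _ zero_le_one fun x => ?_
  rw [one_mul]
  exact (Unitary.norm_map ⟨u, hu⟩ x).le

/-- The isometry given by an element of the orthogonal group. -/
noncomputable abbrev OrthGroup.iso {n : ℕ} (u : OrthGroup n) :
    EuclideanSpace ℝ (Fin n) ≃ₗᵢ[ℝ] EuclideanSpace ℝ (Fin n) :=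
  Unitary.linearIsometryEquiv u

theorem OrthGroup.measurable_apply {n : ℕ} (y : EuclideanSpace ℝ (Fin n)) (i : Fin n) :
    Measurable fun u : OrthGroup n => u.iso y i := by
  refine Continuous.measurable ?_
  have h : Continuous fun u : OrthGroup n =>
      (u : EuclideanSpace ℝ (Fin n) →L[ℝ] EuclideanSpace ℝ (Fin n)) y := by fun_prop
  exact (EuclideanSpace.proj i : EuclideanSpace ℝ (Fin n) →L[ℝ] ℝ).continuous.comp h

theorem OrthGroup.measurable_symm_apply {n : ℕ} (y : EuclideanSpace ℝ (Fin n)) (i : Fin n) :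
    Measurable fun u : OrthGroup n => u.iso.symm y i := by
  have : (fun u : OrthGroup n => u.iso.symm y i) = fun u => (u⁻¹).iso y i := by
    ext u
    simp only [OrthGroup.iso, map_inv]
    rfl
  rw [this]
  exact (OrthGroup.measurable_apply y i).comp measurable_inv

theorem Gr.rotate_mul {n d : ℕ} (u w : OrthGroup n) (V : Gr n d) :
    Gr.rotate (u * w).iso V = Gr.rotate u.iso (Gr.rotate w.iso V) := by
  refine Subtype.ext ?_
  simp only [Gr.rotate]
  rw [← Submodule.map_comp]
  rfl

theorem Gr.measurable_rotate {n d : ℕ} {α : Type*} [MeasurableSpace α] {f : α → OrthGroup n}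
    {g : α → Gr n d} (hf : Measurable f) (hg : Measurable g) :
    Measurable fun z => Gr.rotate (f z).iso (g z) := by
  refine measurable_comap_iff.2 (measurable_pi_iff.2 fun i => measurable_pi_iff.2 fun j => ?_)
  simp only [Function.comp_def, projMatrix_rotate]
  refine Finset.measurable_fun_sum _ fun k _ => Measurable.mul (Finset.measurable_fun_sum _
    fun l _ => Measurable.mul ?_ ?_) ?_
  · exact (OrthGroup.measurable_symm_apply _ l).comp hf
  · have h : Measurable fun V : Gr n d => projMatrix V.1 k l :=
      (measurable_pi_apply l).comp ((measurable_pi_apply k).comp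
        (comap_measurable fun (V : Gr n d) (i j : Fin n) => projMatrix V.1 i j))
    exact h.comp hg
  · exact (OrthGroup.measurable_apply _ i).comp hf

theorem measurable_rotateRows_comp {n d : ℕ} {α : Type*} [MeasurableSpace α]
    {f : α → OrthGroup n} {g : α → Fin n → EuclideanSpace ℝ (Fin d)} (hf : Measurable f)
    (hg : Measurable g) : Measurable fun z => rotateRows (f z).iso (g z) := by
  refine measurable_pi_iff.2 fun i => ?_
  refine (WithLp.measurable_toLp 2 _).comp (measurable_pi_iff.2 fun a => ?_)
  have h : ∀ z : α, _ = _ := fun z =>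
    linearIsometryEquiv_apply_eq_sum (f z).iso (WithLp.toLp 2 fun k => g z k a) i
  refine Eq.mpr (congrArg Measurable (funext h)) ?_
  refine Finset.measurable_fun_sum _ fun k _ => Measurable.mul ?_ ?_
  · fun_prop
  · exact (OrthGroup.measurable_apply _ i).comp hf

/-- Haar probability measure on the orthogonal group. -/
noncomputable def OrthGroup.haar (n : ℕ) : Measure (OrthGroup n) :=
  Measure.haarMeasure ⊤

instance OrthGroup.instIsProbabilityMeasureHaar (n : ℕ) :
    IsProbabilityMeasure (OrthGroup.haar n) :=
  ⟨Measure.haarMeasure_self (K₀ := (⊤ : TopologicalSpace.PositiveCompacts (OrthGroup n)))⟩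

instance OrthGroup.instIsMulLeftInvariantHaar (n : ℕ) :
    (OrthGroup.haar n).IsMulLeftInvariant :=
  Measure.isMulLeftInvariant_haarMeasure _

/-- Transitivity of the action and left invariance of Haar measure; the inverse turns left
translation of `u` into a change of base point. -/
theorem haar_rotate_inv_mem_eq {n d : ℕ} (B : Set (Gr n d)) (V W : Gr n d) :
    OrthGroup.haar n {u | Gr.rotate (u⁻¹).iso V ∈ B} =
      OrthGroup.haar n {u | Gr.rotate (u⁻¹).iso W ∈ B} := by
  obtain ⟨U, hU⟩ := Gr.exists_rotate_eq V W
  let w : OrthGroup n := Unitary.linearIsometryEquiv.symm U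
  have hw : w.iso = U := Unitary.linearIsometryEquiv.apply_symm_apply U
  rw [← hU, ← hw, ← measure_preimage_mul _ w⁻¹ {u | Gr.rotate (u⁻¹).iso V ∈ B}]
  congr 1
  ext u
  simp only [Set.mem_preimage, Set.mem_ofPred_eq, mul_inv_rev, inv_inv, Gr.rotate_mul]

/-- Fubini on the product of Haar measure and `μ`: one order of integration uses the invariance of
`μ`, the other the independence of the base point. In particular `μ` is determined by its
invariance. -/
theorem haar_rotate_inv_mem_eq_measure {n d : ℕ} {μ : Measure (Gr n d)}
    (hμ : IsUniformSubspaceLaw μ) {B : Set (Gr n d)} (hB : MeasurableSet B) (V : Gr n d) :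
    OrthGroup.haar n {u | Gr.rotate (u⁻¹).iso V ∈ B} = μ B := by
  have := hμ.isProbabilityMeasure
  have hS : MeasurableSet {z : OrthGroup n × Gr n d | Gr.rotate (z.1⁻¹).iso z.2 ∈ B} := by
    have : Measurable fun z : OrthGroup n × Gr n d => Gr.rotate (z.1⁻¹).iso z.2 :=
      Gr.measurable_rotate (measurable_inv.comp measurable_fst) measurable_snd
    exact this hB
  have h1 := Measure.prod_apply (μ := OrthGroup.haar n) (ν := μ) hS
  have h2 := Measure.prod_apply_symm (μ := OrthGroup.haar n) (ν := μ) hS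
  have e1 : ∀ u : OrthGroup n, μ (Prod.mk u ⁻¹'
      {z : OrthGroup n × Gr n d | Gr.rotate (z.1⁻¹).iso z.2 ∈ B}) = μ B := fun u =>
    (hμ.invariant (u⁻¹).iso).measure_preimage hB.nullMeasurableSet
  have e2 : ∀ W : Gr n d, OrthGroup.haar n ((fun u => (u, W)) ⁻¹'
      {z : OrthGroup n × Gr n d | Gr.rotate (z.1⁻¹).iso z.2 ∈ B}) =
      OrthGroup.haar n {u | Gr.rotate (u⁻¹).iso V ∈ B} := fun W =>
    haar_rotate_inv_mem_eq B W V
  rw [h1] at h2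
  simp only [e1, e2, lintegral_const, measure_univ, mul_one] at h2
  exact h2.symm

/-- A property of subspaces that is forced by containing the columns of a matrix in `G` is at least
as likely for a uniformly random subspace as `G` is for a Gaussian matrix. -/
theorem gaussianRows_le_uniform {n d : ℕ} {μ : Measure (Gr n d)} (hμ : IsUniformSubspaceLaw μ)
    {G : Set (Fin n → EuclideanSpace ℝ (Fin d))} (hG : MeasurableSet G) {A : Set (Gr n d)}
    (hA : ∀ x ∈ G, ∀ V : Gr n d, (∀ a, WithLp.toLp 2 (fun i => x i a) ∈ V.1) → V ∈ A) :
    (gaussianRows n d).real G ≤ μ.real A := by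
  have := hμ.isProbabilityMeasure
  refine ENNReal.toReal_mono (measure_ne_top _ _) ?_
  -- The set `A` need not be measurable, so Fubini is applied to a measurable hull of the same
  -- measure.
  rw [← measure_toMeasurable A]
  set B := toMeasurable μ A with hBdef
  have hB : MeasurableSet B := measurableSet_toMeasurable μ A
  have hAB : A ⊆ B := subset_toMeasurable μ A
  -- A probability measure lives on a nonempty space, which forces `d ≤ n`.
  obtain ⟨V₀⟩ : Nonempty (Gr n d) := nonempty_of_isProbabilityMeasure μ
  have hdn : d ≤ Module.finrank ℝ (EuclideanSpace ℝ (Fin n)) := by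
    rw [← V₀.2]; exact Submodule.finrank_le _
  have hS : MeasurableSet {z : OrthGroup n × (Fin n → EuclideanSpace ℝ (Fin d)) |
      rotateRows (z.1⁻¹).iso z.2 ∈ G} := by
    have : Measurable fun z : OrthGroup n × (Fin n → EuclideanSpace ℝ (Fin d)) =>
        rotateRows (z.1⁻¹).iso z.2 :=
      measurable_rotateRows_comp (measurable_inv.comp measurable_fst) measurable_snd
    exact this hG
  have h1 := Measure.prod_apply (μ := OrthGroup.haar n) (ν := gaussianRows n d) hS
  have h2 := Measure.prod_apply_symm (μ := OrthGroup.haar n) (ν := gaussianRows n d) hS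
  have e1 : ∀ u : OrthGroup n, gaussianRows n d (Prod.mk u ⁻¹'
      {z : OrthGroup n × (Fin n → EuclideanSpace ℝ (Fin d)) |
        rotateRows (z.1⁻¹).iso z.2 ∈ G}) = gaussianRows n d G := fun u => by
    conv_rhs => rw [← gaussianRows_map_rotateRows (u⁻¹).iso]
    rw [Measure.map_apply (measurable_rotateRows _) hG]
    rfl
  have e2 : ∀ x : Fin n → EuclideanSpace ℝ (Fin d), OrthGroup.haar n ((fun u => (u, x)) ⁻¹'
      {z : OrthGroup n × (Fin n → EuclideanSpace ℝ (Fin d)) |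
        rotateRows (z.1⁻¹).iso z.2 ∈ G}) ≤ μ B := fun x => by
    -- For a fixed matrix `x`, whenever the rotated matrix lies in `G` the rotated `W` contains its
    -- columns and hence lies in `A`. The Haar measure of such rotations is therefore at most `μ B`.
    obtain ⟨W, hW1, hW2⟩ := exists_submodule_ge_finrank_eq hdn
      (Submodule.span ℝ (Set.range fun a : Fin d =>
        (WithLp.toLp 2 (fun i => x i a) : EuclideanSpace ℝ (Fin n))))
      ((finrank_range_le_card _).trans_eq (Fintype.card_fin d))
    rw [← haar_rotate_inv_mem_eq_measure hμ hB ⟨W, hW2⟩]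
    refine measure_mono fun u hu => hAB (hA _ hu _ fun a => ?_)
    rw [rotateRows_col]
    exact ⟨_, hW1 (Submodule.subset_span ⟨a, rfl⟩), rfl⟩
  rw [h1] at h2
  simp only [e1, lintegral_const, measure_univ, mul_one] at h2
  rw [h2]
  refine (lintegral_mono e2).trans_eq ?_
  simp

/-! ### Choice of parameters as powers of one scale. -/

/-- The scale `n ^ (-1/100)`, of which all parameters are powers. -/
noncomputable def scale (n : ℕ) : ℝ := (n : ℝ) ^ (-0.01 : ℝ)

theorem tendsto_scale : Filter.Tendsto scale Filter.atTop (nhds 0) := by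
  have := (tendsto_rpow_neg_atTop (y := 0.01) (by norm_num)).comp tendsto_natCast_atTop_atTop
  exact this

theorem scale_pos {n : ℕ} (hn : 0 < n) : 0 < scale n := Real.rpow_pos_of_pos (by positivity) _

theorem natCast_mul_scale_pow {n : ℕ} (hn : 0 < n) : (n : ℝ) * scale n ^ 100 = 1 := by
  have hn' : (0 : ℝ) < n := by positivity
  rw [scale, ← Real.rpow_natCast, ← Real.rpow_mul hn'.le]
  norm_num
  rw [Real.rpow_neg hn'.le, Real.rpow_one, mul_inv_cancel₀ hn'.ne']

theorem inv_le_scale_pow {n d : ℕ} (hn : 0 < n) (hd : (n : ℝ) ^ (0.99 : ℝ) ≤ (d : ℝ)) :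
    (d : ℝ)⁻¹ ≤ scale n ^ 99 := by
  have hn' : (0 : ℝ) < n := by positivity
  have h : scale n ^ 99 = ((n : ℝ) ^ (0.99 : ℝ))⁻¹ := by
    rw [scale, ← Real.rpow_natCast, ← Real.rpow_mul hn'.le, ← Real.rpow_neg hn'.le]
    norm_num
  rw [h]
  exact inv_anti₀ (Real.rpow_pos_of_pos hn' _) hd

/-- The loss in the value of the relaxation. -/
noncomputable def valueLoss (n : ℕ) : ℝ := 1 - (1 + scale n ^ 4)⁻¹ * (1 - scale n ^ 50)

/-- The bound on the failure probability, once `n` is large. -/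
noncomputable def failureBound (n : ℕ) : ℝ :=
  (∫ x, x ^ 60 ∂gaussianReal 0 1) * scale n ^ 70 + (8 * scale n ^ 104 + 4 * scale n ^ 6) +
    2 * scale n ^ 49

open Classical in
/-- The failure probability allowed. -/
noncomputable def failureProb (n : ℕ) : ℝ :=
  if 0 < n ∧ 18 * scale n ^ 2 ≤ 1 then failureBound n else 1

theorem tendsto_valueLoss : Filter.Tendsto valueLoss Filter.atTop (nhds 0) := by
  have h : Continuous fun s : ℝ => 1 - (1 + s ^ 4)⁻¹ * (1 - s ^ 50) := by
    refine continuous_const.sub (Continuous.mul (Continuous.inv₀ (by fun_prop) fun s => ?_)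
      (by fun_prop))
    positivity
  have := (h.tendsto 0).comp tendsto_scale
  unfold valueLoss
  simpa [Function.comp_def] using this

theorem tendsto_failureProb : Filter.Tendsto failureProb Filter.atTop (nhds 0) := by
  have h : Filter.Tendsto failureBound Filter.atTop (nhds 0) := by
    have h : Continuous fun s : ℝ => (∫ x, x ^ 60 ∂gaussianReal 0 1) * s ^ 70 +
        (8 * s ^ 104 + 4 * s ^ 6) + 2 * s ^ 49 := by fun_prop
    have := (h.tendsto 0).comp tendsto_scale
    unfold failureBound
    simpa [Function.comp_def] using this
  refine h.congr' ?_
  have h2 : Filter.Tendsto (fun n => 18 * scale n ^ 2) Filter.atTop (nhds 0) := by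
    simpa using (tendsto_scale.pow 2).const_mul 18
  filter_upwards [h2.eventually (ge_mem_nhds zero_lt_one), Filter.eventually_gt_atTop 0]
    with n h1 h0
  exact (if_pos ⟨h0, h1⟩).symm

/-- With `n = s ^ (-100)` and `1 / d ≤ s ^ 99`, only exponents have to be counted. The moment order
30 is large enough to beat the `n ^ 2` pairs at threshold `θ = s ^ 90`: the exponent is `30 * (99 -
90) - 200 = 70`. -/
theorem failure_le_failureBound {n d : ℕ} {s : ℝ} {K : ℝ} (hK : 0 ≤ K) (hn : 0 < n) (hd : 0 < d)
    (hs : 0 < s) (hns : (n : ℝ) * s ^ 100 = 1) (hds : (d : ℝ)⁻¹ ≤ s ^ 99) :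
    (n : ℝ) ^ 2 * (K / (d : ℝ) ^ 30) / (s ^ 90) ^ 30 +
      (n : ℝ) ^ 2 * (n ^ 2 * (2 / ((d : ℝ) * (d + 2))) ^ 3 +
        n * (2 / ((d : ℝ) * (d + 2))) ^ 2) / (s ^ 45) ^ 2 + n * (2 / (d : ℝ)) / (s ^ 50 * n) ≤
    K * s ^ 70 + (8 * s ^ 104 + 4 * s ^ 6) + 2 * s ^ 49 := by
  have hn' : (0 : ℝ) < n := by positivity
  have hd' : (0 : ℝ) < d := by positivity
  have hN : (n : ℝ) = (s ^ 100)⁻¹ := eq_inv_of_mul_eq_one_left hns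
  have hσ : 2 / ((d : ℝ) * (d + 2)) ≤ 2 * s ^ 198 := by
    calc 2 / ((d : ℝ) * (d + 2)) ≤ 2 / ((d : ℝ) * d) := by gcongr; linarith
      _ = 2 * ((d : ℝ)⁻¹ * (d : ℝ)⁻¹) := by rw [← mul_inv]; rfl
      _ ≤ 2 * (s ^ 99 * s ^ 99) := by gcongr
      _ = 2 * s ^ 198 := by ring
  have hσ0 : 0 ≤ 2 / ((d : ℝ) * (d + 2)) := by positivity
  refine add_le_add (add_le_add ?_ ?_) ?_
  · calc (n : ℝ) ^ 2 * (K / (d : ℝ) ^ 30) / (s ^ 90) ^ 30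
        = (n : ℝ) ^ 2 * (K * (d : ℝ)⁻¹ ^ 30) / (s ^ 90) ^ 30 := by rw [inv_pow]; rfl
      _ ≤ (n : ℝ) ^ 2 * (K * (s ^ 99) ^ 30) / (s ^ 90) ^ 30 := by gcongr
      _ = K * s ^ 70 := by rw [hN]; field_simp
  · calc (n : ℝ) ^ 2 * (n ^ 2 * (2 / ((d : ℝ) * (d + 2))) ^ 3 +
          n * (2 / ((d : ℝ) * (d + 2))) ^ 2) / (s ^ 45) ^ 2
        ≤ (n : ℝ) ^ 2 * (n ^ 2 * (2 * s ^ 198) ^ 3 + n * (2 * s ^ 198) ^ 2) / (s ^ 45) ^ 2 := by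
          gcongr
      _ = 8 * s ^ 104 + 4 * s ^ 6 := by rw [hN]; field_simp; ring
  · calc n * (2 / (d : ℝ)) / (s ^ 50 * n) = 2 * (d : ℝ)⁻¹ / s ^ 50 := by field_simp
      _ ≤ 2 * s ^ 99 / s ^ 50 := by gcongr
      _ = 2 * s ^ 49 := by field_simp

/-- Here `η = s ^ 20`, `τ = s ^ 4`, `θ = s ^ 90`, `f = s ^ 45` and `κ = s ^ 50`. The main
constraints are `η * n * θ = s ^ 10` against `τ ^ 2 = s ^ 8`, and `f = s ^ 45` against `η ^ 2 = s ^
40`. -/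
theorem exists_sos4_of_goodRows_scale {n d : ℕ} (hn : 0 < n) (hd : 0 < d)
    (hs : 18 * scale n ^ 2 ≤ 1) (hds : (d : ℝ)⁻¹ ≤ scale n ^ 99)
    {x : Fin n → EuclideanSpace ℝ (Fin d)}
    (hx : x ∈ goodRows n d 30 (scale n ^ 90) (scale n ^ 45) (scale n ^ 50))
    (V : Submodule ℝ (EuclideanSpace ℝ (Fin n)))
    (hV : ∀ a, WithLp.toLp 2 (fun i => x i a) ∈ V) :
    ∃ M : Matrix (SmallSet n) (SmallSet n) ℝ,
      IsSoS4 M ∧ 1 - valueLoss n ≤ (1 / (n : ℝ)) * sosValue (projMatrix V) M := by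
  have hs0 := scale_pos hn
  have hns := natCast_mul_scale_pow hn
  set s := scale n with hsdef
  have hs1 : s ≤ 1 := by nlinarith
  have hN : (n : ℝ) = (s ^ 100)⁻¹ := eq_inv_of_mul_eq_one_left hns
  have hle : ∀ {k l : ℕ}, l ≤ k → s ^ k ≤ s ^ l := fun h => pow_le_pow_of_le_one hs0.le hs1 h
  -- The constant 18 is what the constraint `2 * s ^ 42 ≤ (s ^ 20 / 3) ^ 2` requires; the other
  -- constraints need less.
  have hsub : ∀ k : ℕ, 18 * s ^ (k + 2) ≤ s ^ k := fun k => by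
    have := mul_le_mul_of_nonneg_left hs (pow_nonneg hs0.le k)
    rw [pow_add]; linarith
  have hval : 1 - valueLoss n = (1 + s ^ 4)⁻¹ * (1 - s ^ 50) := by
    rw [valueLoss, ← hsdef]; ring
  rw [hval]
  refine exists_sos4_of_goodRows hn hd (by norm_num) (η := s ^ 20) (pow_pos hs0 _).le
    (pow_pos hs0 _).le (pow_pos hs0 _) (pow_le_one₀ hs0.le hs1) (hle (by norm_num)) ?_ ?_ ?_ ?_
    hx V hV
  · rw [one_div]
    exact hds.trans (hle (by norm_num))
  · calc 2 * s ^ 90 + 2 * n * (s ^ 90) ^ 2 + 4 * s ^ 20 * n * s ^ 90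
        = 2 * s ^ 90 + 2 * s ^ 80 + 4 * s ^ 10 := by rw [hN]; field_simp
      _ ≤ 2 * s ^ 10 + 2 * s ^ 10 + 4 * s ^ 10 := by
          gcongr 2 * ?_ + 2 * ?_ + _
          · exact hle (by norm_num)
          · exact hle (by norm_num)
      _ ≤ (s ^ 4) ^ 2 := by
          have := hsub 8
          have h10 : 0 ≤ s ^ 10 := by positivity
          rw [← pow_mul]; norm_num at this ⊢; linarith
  · calc (1 + 3 / s ^ 20) * (n / (d : ℝ) ^ 2)
        = (1 + 3 / s ^ 20) * (n * (d : ℝ)⁻¹ ^ 2) := by rw [inv_pow]; rfl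
      _ ≤ (1 + 3 / s ^ 20) * (n * (s ^ 99) ^ 2) := by gcongr
      _ = s ^ 98 + 3 * s ^ 78 := by rw [hN]; field_simp
      _ ≤ s ^ 20 / 2 := by
          have h1 : s ^ 98 ≤ s ^ 22 := hle (by norm_num)
          have h2 : s ^ 78 ≤ s ^ 22 := hle (by norm_num)
          have := hsub 20
          have h22 : 0 ≤ s ^ 22 := by positivity
          norm_num at this
          linarith
  · calc n * (s ^ 90) ^ 2 + s ^ 45 = s ^ 80 + s ^ 45 := by rw [hN]; field_simp
      _ ≤ (s ^ 20 / 3) ^ 2 := by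
          have h1 : s ^ 80 ≤ s ^ 42 := hle (by norm_num)
          have h2 : s ^ 45 ≤ s ^ 42 := hle (by norm_num)
          have := hsub 40
          norm_num at this
          rw [div_pow, ← pow_mul]
          norm_num
          linarith

end

theorem theorem1p6 :
    ∃ ε δ : ℕ → ℝ,
      Filter.Tendsto ε Filter.atTop (nhds 0) ∧ Filter.Tendsto δ Filter.atTop (nhds 0) ∧
      ∀ (n d : ℕ), (n : ℝ) ^ (0.99 : ℝ) ≤ (d : ℝ) →
        ∀ μ : MeasureTheory.Measure (Gr n d), IsUniformSubspaceLaw μ →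
          1 - δ n ≤ μ.real {V : Gr n d | ∃ M : Matrix (SmallSet n) (SmallSet n) ℝ,
            IsSoS4 M ∧ 1 - ε n ≤ (1 / (n : ℝ)) * sosValue (projMatrix V.1) M} := by
  refine ⟨valueLoss, failureProb, tendsto_valueLoss, tendsto_failureProb,
    fun n d hnd μ hμ => ?_⟩
  by_cases h : 0 < n ∧ 18 * scale n ^ 2 ≤ 1
  · obtain ⟨hn, hs⟩ := h
    have hs0 := scale_pos hn
    have hd : 0 < d := by
      have : (0 : ℝ) < n ^ (0.99 : ℝ) := Real.rpow_pos_of_pos (by positivity) _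
      exact_mod_cast this.trans_le hnd
    have hds := inv_le_scale_pow hn hnd
    have hK : 0 ≤ ∫ x : ℝ, x ^ 60 ∂ProbabilityTheory.gaussianReal 0 1 :=
      MeasureTheory.integral_nonneg fun x => Even.pow_nonneg (by decide) x
    have hgauss := measureReal_goodRows_ge hn hd 30 (pow_pos hs0 90) (pow_pos hs0 45)
      (pow_pos hs0 50)
    have hfail := failure_le_failureBound hK hn hd hs0 (natCast_mul_scale_pow hn) hds
    refine le_trans ?_ (gaussianRows_le_uniform hμ
      (measurableSet_goodRows n d 30 (scale n ^ 90) (scale n ^ 45) (scale n ^ 50))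
      fun x hx V hV => exists_sos4_of_goodRows_scale hn hd hs hds hx V.1 hV)
    refine le_trans ?_ hgauss
    rw [failureProb, if_pos ⟨hn, hs⟩, failureBound]
    linarith
  -- For `n = 0` and for the finitely many small `n` the allowed failure probability is 1.
  · rw [failureProb, if_neg h, sub_self]
    exact MeasureTheory.measureReal_nonneg
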